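/- Let $M,K,N\ge 1$ be integers with $\gcd(M,K)=1$ and $\gcd(M+K,N)=1$. Let $I_n^t, V_n^t\in\mathbb{C}$ $(n,t\in\mathbb{Z})$, with all $I_n^t\neq 0$, satisfy $$I_n^t=I_{n-1}^{t-M}+V_n^{t-K}-V_{n-1}^t,\qquad V_n^t=\frac{I_n^{t-M}V_n^{t-K}}{I_n^t},\qquad I_{n+N}^t=I_n^t,\quad V_{n+N}^t=V_n^t .$$ Let $S(y)$ be the $N\times N$ matrix with entries $1$ on the superdiagonal, $y$ in the lower left corner and $0$ elsewhere (for $N=1$, $S(y)=(y)$), and put $R_t(y)=\mathrm{diag}(I_1^t,\dots,I_N^t)+S(y)$, $L_t(y)=\mathrm{diag}(V_1^t,\dots,V_N^t)+S(y)$. Fix $t\in\mathbb{Z}$ and let $$X_t(y)=L_{t-(K-1)M}(y)\cdots L_{t-M}(y)L_t(y)\cdot R_t(y)R_{t-K}(y)\cdots R_{t-(M-1)K}(y).$$ Let $C$ be the spectral curve, the completion of the affine curve $\{(x,y)\in\mathbb{C}^2 : \det(X_t(y)-xE)=0\}$, and assume that $C$ is smooth (that is, the affine curve has no singular point; at infinity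 the smooth completion is taken). For a vector $w=(w_i)_i$ of meromorphic functions on $C$ and a point $p\in C$ let $\mathrm{ord}\,w(p)=\min_i \mathrm{ord}_p(w_i)$. Then each of the following describes exactly one point of $C$: $$Q_1:\ (x,y)=(U_1,0),\qquad U_1=V_1^{t-(K-1)M}\cdots V_1^{t-M}V_1^t\cdot I_1^tI_1^{t-K}\cdots I_1^{t-(M-1)K},$$ $$A:\ (x,y)=\Bigl(0,(-1)^N\prod_{n=1}^N I_n^{t-(M-1)K}\Bigr),\qquad B:\ (x,y)=\Bigl(0,(-1)^N\prod_{n=1}^N V_n^{t-MK}\Bigr),\qquad P:\ (x,y)=(\infty,\infty).$$ If $\prod_n I_n^{s+M}=\prod_n I_n^{s}$ for all $s$, then $A$ is the point $A_j=(0,(-1)^N\prod_n I_n^{-jK})$ for the index $0\le j<M$ with $-jK\equiv t-(M-1)K \pmod M$; if $\prod_n V_n^{s+K}=\prod_n V_n^{s}$ for all $s$, then $B$ is the point $B_i=(0,(-1)^N\prod_n V_n^{-iM})$ for the index $0\le i<K$ with $-iM\equiv t-MK\pmod K$. Write $S=S(y)$, $R=R_{t-(M-1)K}(y)$, $L=L_{t-MK}(y)$.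 For every nonzero vector $v$ of meromorphic functions on $C$ with $X_t(y)v=xv$: (i) $\mathrm{ord}\,(Sv)(Q_1)=\mathrm{ord}\,v(Q_1)+1$, $\ \mathrm{ord}\,(Sv)(P)=\mathrm{ord}\,v(P)-1$, and $\mathrm{ord}\,(Sv)(p)=\mathrm{ord}\,v(p)$ for all $p\in C\setminus\{Q_1,P\}$; (ii) $\mathrm{ord}\,(Rv)(A)=\mathrm{ord}\,v(A)+1$, $\ \mathrm{ord}\,(Rv)(P)=\mathrm{ord}\,v(P)-1$, and $\mathrm{ord}\,(Rv)(p)=\mathrm{ord}\,v(p)$ for all $p\in C\setminus\{A,P\}$; (iii) $\mathrm{ord}\,(Lv)(B)=\mathrm{ord}\,v(B)+1$, $\ \mathrm{ord}\,(Lv)(P)=\mathrm{ord}\,v(P)-1$, and $\mathrm{ord}\,(Lv)(p)=\mathrm{ord}\,v(p)$ for all $p\in C\setminus\{B,P\}$. -/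

import Mathlib

open Polynomial

namespace RndKP

/-- `I n t = I_n^t` and `V n t = V_n^t` (all `n, t : ℤ`) solve the `(M, K)`-reduced non-autonomous
discrete KP equation with the `N`-periodic boundary condition. Since the second equation divides
by `I_n^t`, these numbers are nonzero. -/
structure IsPeriodicSolution (M K N : ℕ) (I V : ℤ → ℤ → ℂ) : Prop where
  I_ne_zero : ∀ n t, I n t ≠ 0
  eq_I : ∀ n t, I n t = I (n - 1) (t - M) + V n (t - K) - V (n - 1) t
  eq_V : ∀ n t, V n t = I n (t - M) * V n (t - K) / I n t
  periodic_I : ∀ n t, I (n + N) t = I n t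
  periodic_V : ∀ n t, V (n + N) t = V n t

section Matrices

variable {R : Type*} [CommRing R] [Algebra ℂ R]

/-- The `N × N` matrix with diagonal `a 1, …, a N`, with entries `1` on the superdiagonal and with
`y` in the lower left corner (added to the diagonal entry if `N = 1`). The row with index
`i : Fin N` is the row number `i + 1` of the usual numbering. -/
def cyclicBidiagonal (N : ℕ) (a : ℤ → ℂ) (y : R) : Matrix (Fin N) (Fin N) R :=
  Matrix.of fun i j =>
    (if i = j then algebraMap ℂ R (a ((i : ℕ) + 1)) else 0) +
    (if (i : ℕ) + 1 = (j : ℕ) then 1 else 0) +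
    (if (i : ℕ) + 1 = N ∧ (j : ℕ) = 0 then y else 0)

/-- The shift matrix `S`. -/
def shiftMatrix (N : ℕ) (y : R) : Matrix (Fin N) (Fin N) R :=
  cyclicBidiagonal N (fun _ => 0) y

/-- The matrix `L_t(y)`. -/
def lMatrix (N : ℕ) (V : ℤ → ℤ → ℂ) (t : ℤ) (y : R) : Matrix (Fin N) (Fin N) R :=
  cyclicBidiagonal N (fun n => V n t) y

/-- The matrix `R_t(y)`. -/
def rMatrix (N : ℕ) (I : ℤ → ℤ → ℂ) (t : ℤ) (y : R) : Matrix (Fin N) (Fin N) R :=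
  cyclicBidiagonal N (fun n => I n t) y

/-- The matrix
`X_t(y) = L_{t-(K-1)M}(y) ⋯ L_{t-M}(y) L_t(y) · R_t(y) R_{t-K}(y) ⋯ R_{t-(M-1)K}(y)`. -/
def xMatrix (M K N : ℕ) (I V : ℤ → ℤ → ℂ) (t : ℤ) (y : R) : Matrix (Fin N) (Fin N) R :=
  (((List.range K).reverse.map fun i => lMatrix N V (t - i * M) y).prod) *
  (((List.range M).map fun j => rMatrix N I (t - j * K) y).prod)

end Matrices

/-- The polynomial `F(x, y) = det (x E - X_t(y)) = ± det (X_t(y) - x E)`, as a polynomial in `x`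
(outer variable) with coefficients in `ℂ[y]`. -/
noncomputable def spectralPoly (M K N : ℕ) (I V : ℤ → ℤ → ℂ) (t : ℤ) : ℂ[X][X] :=
  (xMatrix M K N I V t (X : ℂ[X])).charpoly

/-- The spectral curve is smooth: at no point `(x₀, y₀)` of the affine curve `F(x, y) = 0` do
both partial derivatives `∂F/∂x` and `∂F/∂y` vanish. (At infinity, the completion is the smooth
one by definition, its points being the places of the function field.) -/
def IsSmooth (M K N : ℕ) (I V : ℤ → ℤ → ℂ) (t : ℤ) : Prop :=
  ∀ x₀ y₀ : ℂ, (spectralPoly M K N I V t).evalEval y₀ x₀ = 0 →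
    (derivative ((spectralPoly M K N I V t).map (evalRingHom y₀))).eval x₀ ≠ 0 ∨
    (derivative ((spectralPoly M K N I V t).eval (C x₀))).eval y₀ ≠ 0

/-- The coordinate ring `ℂ[x, y] / (F)` of the affine spectral curve. -/
abbrev CoordinateRing (M K N : ℕ) (I V : ℤ → ℤ → ℂ) (t : ℤ) : Type :=
  AdjoinRoot (spectralPoly M K N I V t)

/-- The ring of rational functions (that is, of meromorphic functions) on the spectral curve:
the total ring of fractions of `ℂ[x, y] / (F)`. It is a field if `M + K` and `N` are coprime,
because `F` is irreducible then. -/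
abbrev FunctionField (M K N : ℕ) (I V : ℤ → ℤ → ℂ) (t : ℤ) : Type :=
  FractionRing (CoordinateRing M K N I V t)

/-- The coordinate function `x` on the spectral curve. -/
noncomputable def xFun (M K N : ℕ) (I V : ℤ → ℤ → ℂ) (t : ℤ) : FunctionField M K N I V t :=
  algebraMap (CoordinateRing M K N I V t) (FunctionField M K N I V t)
    (AdjoinRoot.root (spectralPoly M K N I V t))

/-- The coordinate function `y` on the spectral curve. -/
noncomputable def yFun (M K N : ℕ) (I V : ℤ → ℤ → ℂ) (t : ℤ) : FunctionField M K N I V t :=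
  algebraMap (CoordinateRing M K N I V t) (FunctionField M K N I V t)
    (AdjoinRoot.of (spectralPoly M K N I V t) X)

/-- The points of the complete smooth spectral curve `C`, as the places of its function field:
normalised discrete valuations that are trivial on the constants. The valuation belonging to the
point `p` is the order of vanishing `f ↦ ord f(p)`, with `ord 0 = ⊤`. -/
structure SpectralCurve (M K N : ℕ) (I V : ℤ → ℤ → ℂ) (t : ℤ) where
  ord : AddValuation (FunctionField M K N I V t) (WithTop ℤ)
  surjective : Function.Surjective ord
  ord_const : ∀ c : ℂ, c ≠ 0 → ord (algebraMap ℂ (FunctionField M K N I V t) c) = 0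

namespace SpectralCurve

variable {M K N : ℕ} {I V : ℤ → ℤ → ℂ} {t : ℤ}

/-- The point `p` is a finite point with coordinates `(x, y) = (a, b)`. -/
def HasCoords (p : SpectralCurve M K N I V t) (a b : ℂ) : Prop :=
  0 < p.ord (xFun M K N I V t - algebraMap ℂ _ a) ∧
  0 < p.ord (yFun M K N I V t - algebraMap ℂ _ b)

/-- The point `p` has coordinates `(x, y) = (∞, ∞)`. -/
def AtInfinity (p : SpectralCurve M K N I V t) : Prop :=
  p.ord (xFun M K N I V t) < 0 ∧ p.ord (yFun M K N I V t) < 0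

/-- The order of a vector of rational functions at `p`: the minimum of the orders of its
components. -/
noncomputable def vecOrd (p : SpectralCurve M K N I V t)
    (v : Fin N → FunctionField M K N I V t) : WithTop ℤ :=
  Finset.univ.inf fun i => p.ord (v i)

end SpectralCurve

/-- `v` is a nonzero vector of rational functions on `C` with `X_t(y) v = x v`. -/
def IsEigenvector (M K N : ℕ) (I V : ℤ → ℤ → ℂ) (t : ℤ)
    (v : Fin N → FunctionField M K N I V t) : Prop :=
  v ≠ 0 ∧ (xMatrix M K N I V t (yFun M K N I V t)).mulVec v = xFun M K N I V t • v

/-- `U_1 = V_1^{t-(K-1)M} ⋯ V_1^{t-M} V_1^t · I_1^t I_1^{t-K} ⋯ I_1^{t-(M-1)K}`. -/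
noncomputable def uOne (M K : ℕ) (I V : ℤ → ℤ → ℂ) (t : ℤ) : ℂ :=
  (∏ i ∈ Finset.range K, V 1 (t - i * M)) * ∏ j ∈ Finset.range M, I 1 (t - j * K)

/-- The product `a_1^s a_2^s ⋯ a_N^s` over one period. -/
noncomputable def periodProd (N : ℕ) (a : ℤ → ℤ → ℂ) (s : ℤ) : ℂ :=
  ∏ n ∈ Finset.Icc 1 N, a n s

end RndKP

/-! All three order statements come from one mechanism, `exists_point_of_factor`. Suppose `X_t(y) -
c = Y(y) T(y)` with `T` cyclic bidiagonal. Then `det T` is `y - y₀` up to sign, and an eigenvector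
`v` satisfies `Y (T v) = (x - c) v` and `adj(T) (T v) = ±(y - y₀) v`. Where `y` is finite, all these
matrices are regular, so `ord v ≤ ord (T v)`, and the gain is at most `ord (x - c)` and at most `ord
(y - y₀)`. The order can therefore change only at `(c, y₀)`. Smoothness makes one of the two
functions a local parameter there, so the gain is at most one. It is at least one because the
eigenspace at a smooth point is a line (`exists_eq_smul_of_smooth`): the residue of the normalised
`v` lies on that line, which also contains the kernel of `T(y₀)`, so `T v` vanishes to higher order.

The factorisations are of three kinds. `R` is the last factor of `X_t`, with `c = 0`. `L` becomes a
last factor through the exchange relation `lMatrix_mul_rMatrix`, the matrix form of the evolution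
equations. For `S`, the matrix `X_t(0)` is upper triangular with first diagonal entry `U_1`, so the
first column of `X_t - U_1` is divisible by `y`.

At a pole of `y`, the shift part of each factor dominates its diagonal once the components of `v`
are suitably weighted. The set of components of minimal weighted order is invariant under a cyclic
shift by `M + K`, hence is everything by coprimality (`profile_of_eigenvector`). This gives the drop
by one at infinity and forces `ord x : ord y = M + K : N`. The monomials `y^a x^i` with `i < N` then
have distinct orders, so only one place at infinity is possible. It exists by Hensel's lemma after
the substitution `y = s^(-N)`; the same expansion embeds the coordinate ring in a field, so that
ring is a domain. At a smooth affine point a place exists by Hensel's lemma and is unique because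
the ideal of the point is locally principal. -/

namespace RndKP

/-! ### Bidiagonal matrices: base change, exchange relation, determinant -/

section Matrices

variable {R : Type*} [CommRing R] [Algebra ℂ R]

theorem cyclicBidiagonal_map {R' : Type*} [CommRing R'] [Algebra ℂ R'] (f : R →ₐ[ℂ] R')
    (N : ℕ) (a : ℤ → ℂ) (y : R) :
    f.mapMatrix (cyclicBidiagonal N a y) = cyclicBidiagonal N a (f y) := by
  ext i j
  simp only [cyclicBidiagonal, AlgHom.mapMatrix_apply, Matrix.map_apply, Matrix.of_apply, map_add]
  congr 1
  · congr 1
    · split_ifs <;> simp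
    · split_ifs <;> simp
  · split_ifs <;> simp

/-- In `xMatrix` the whole index list is coerced to integers; here each natural index is cast inside
the factor, which is the form that list induction needs. -/
theorem xMatrix_eq (M K N : ℕ) (I V : ℤ → ℤ → ℂ) (t : ℤ) (y : R) :
    xMatrix M K N I V t y =
      ((List.range K).reverse.map fun i : ℕ => lMatrix N V (t - i * M) y).prod *
      ((List.range M).map fun j : ℕ => rMatrix N I (t - j * K) y).prod := by
  simp only [xMatrix, bind_pure_comp, List.map_eq_map, List.map_map, Function.comp_def]

theorem xMatrix_map {R' : Type*} [CommRing R'] [Algebra ℂ R'] (f : R →ₐ[ℂ] R')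
    (M K N : ℕ) (I V : ℤ → ℤ → ℂ) (t : ℤ) (y : R) :
    f.mapMatrix (xMatrix M K N I V t y) = xMatrix M K N I V t (f y) := by
  simp only [xMatrix_eq, map_mul, map_list_prod, List.map_map, lMatrix, rMatrix, Function.comp_def,
    cyclicBidiagonal_map]

theorem cyclicBidiagonal_eq (N : ℕ) (a : ℤ → ℂ) (y : R) :
    cyclicBidiagonal N a y =
      Matrix.diagonal (fun i : Fin N => algebraMap ℂ R (a ((i : ℕ) + 1))) + shiftMatrix N y := by
  ext i j
  simp [cyclicBidiagonal, shiftMatrix, Matrix.diagonal_apply, add_assoc]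

/-- Moving a diagonal matrix across `S` advances its index by one; periodicity is what makes this
true for the corner entry. -/
theorem shiftMatrix_mul_diagonal {N : ℕ} {a : ℤ → ℂ} (ha : ∀ n, a (n + N) = a n) (y : R) :
    shiftMatrix N y * Matrix.diagonal (fun i : Fin N => algebraMap ℂ R (a ((i : ℕ) + 1))) =
      Matrix.diagonal (fun i : Fin N => algebraMap ℂ R (a ((i : ℕ) + 1 + 1))) *
        shiftMatrix N y := by
  ext i j
  rw [Matrix.mul_diagonal, Matrix.diagonal_mul]
  simp only [shiftMatrix, cyclicBidiagonal, Matrix.of_apply, map_zero, ite_self, zero_add]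
  by_cases h1 : (i : ℕ) + 1 = j
  · have h2 : ¬((i : ℕ) + 1 = N ∧ (j : ℕ) = 0) := by omega
    have : ((j : ℕ) : ℤ) + 1 = (i : ℕ) + 1 + 1 := by omega
    rw [if_pos h1, if_neg h2, this]; simp
  · by_cases h2 : (i : ℕ) + 1 = N ∧ (j : ℕ) = 0
    · have h3 := ha 1
      have : ((i : ℕ) : ℤ) + 1 + 1 = 1 + N := by omega
      rw [this, h3]
      simp [h2, mul_comm]
    · simp [h1, h2]

/-- Both sides are expanded as diagonal + diagonal·`S` + `S²`. The diagonal terms agree by `eq_V`,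
the coefficients of `S` by `eq_I` with `n` replaced by `n + 1`. -/
theorem lMatrix_mul_rMatrix {M K N : ℕ} {I V : ℤ → ℤ → ℂ} (h : IsPeriodicSolution M K N I V)
    (t : ℤ) (y : R) :
    lMatrix N V t y * rMatrix N I t y = rMatrix N I (t - M) y * lMatrix N V (t - K) y := by
  simp only [lMatrix, rMatrix, cyclicBidiagonal_eq, add_mul, mul_add]
  rw [shiftMatrix_mul_diagonal (a := fun n => I n t) (fun n => h.periodic_I n t),
    shiftMatrix_mul_diagonal (a := fun n => V n (t - K)) (fun n => h.periodic_V n (t - K)),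
    Matrix.diagonal_mul_diagonal, Matrix.diagonal_mul_diagonal]
  have h1 : ∀ n, V n t * I n t = I n (t - M) * V n (t - K) := fun n => by
    rw [h.eq_V n t, div_mul_cancel₀ _ (h.I_ne_zero n t)]
  have h2 : ∀ n, V n t + I (n + 1) t = I n (t - M) + V (n + 1) (t - K) := fun n => by
    have := h.eq_I (n + 1) t
    rw [add_sub_cancel_right] at this
    rw [this]; ring
  simp only [← map_mul, h1]
  have key : ∀ a b c d : Matrix (Fin N) (Fin N) R, ∀ s q : Matrix (Fin N) (Fin N) R,
      a + b = c + d → q + b * s + (a * s + s * s) = q + d * s + (c * s + s * s) := by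
    intro a b c d s q e
    have : a * s + b * s = c * s + d * s := by rw [← add_mul, e, add_mul]
    calc _ = q + (a * s + b * s) + s * s := by abel
      _ = _ := by rw [this]; abel
  apply key
  rw [Matrix.diagonal_add, Matrix.diagonal_add]
  congr 1
  ext i
  rw [← map_add, ← map_add, h2]

theorem cyclicBidiagonal_apply (N : ℕ) (a : ℤ → ℂ) (y : R) (i j : Fin N) :
    cyclicBidiagonal N a y i j =
      (if (i : ℕ) = j then algebraMap ℂ R (a ((i : ℕ) + 1)) else 0) +
      (if (i : ℕ) + 1 = (j : ℕ) then 1 else 0) +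
      (if (i : ℕ) + 1 = N ∧ (j : ℕ) = 0 then y else 0) := by
  simp [cyclicBidiagonal, Fin.ext_iff]

theorem det_cyclicBidiagonal_zero (N : ℕ) (a : ℤ → ℂ) :
    (cyclicBidiagonal N a (0 : R)).det = algebraMap ℂ R (∏ n ∈ Finset.Icc 1 N, a n) := by
  rw [Matrix.det_of_isUpperTriangular]
  · simp only [cyclicBidiagonal_apply, map_prod]
    have : ∀ n : ℕ, ∏ i : Fin n, algebraMap ℂ R (a ((i : ℕ) + 1)) =
        ∏ i ∈ Finset.Icc (1 : ℕ) n, algebraMap ℂ R (a i) := by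
      intro n
      induction n with
      | zero => simp
      | succ n ih => rw [Fin.prod_univ_castSucc, Finset.prod_Icc_succ_top (by omega)]; simp [ih]
    simpa using this N
  · intro i j hij
    have hij' : (j : ℕ) < i := hij
    rw [cyclicBidiagonal_apply, if_neg (by omega), if_neg (by omega)]
    simp

/-- The determinant is affine in `y` through the last row. Its constant term is triangular, and the
minor belonging to the corner is lower triangular with ones on the diagonal. -/
theorem det_cyclicBidiagonal {N : ℕ} (hN : 0 < N) (a : ℤ → ℂ) (y : R) :
    (cyclicBidiagonal N a y).det =
      algebraMap ℂ R (∏ n ∈ Finset.Icc 1 N, a n) - (-1) ^ N * y := by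
  obtain ⟨n, rfl⟩ : ∃ n, N = n + 1 := ⟨N - 1, by omega⟩
  have h1 : cyclicBidiagonal (n + 1) a y =
      (cyclicBidiagonal (n + 1) a 0).updateRow (Fin.last n)
        (cyclicBidiagonal (n + 1) a 0 (Fin.last n) + y • Pi.single 0 1) := by
    ext i j
    by_cases hi : i = Fin.last n
    · subst hi
      rw [Matrix.updateRow_self, Pi.add_apply, Pi.smul_apply]
      by_cases hj : j = 0
      · subst hj; simp [cyclicBidiagonal_apply]
      · have : (j : ℕ) ≠ 0 := fun h => hj (Fin.ext h)
        simp [cyclicBidiagonal_apply, hj]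
    · have : (i : ℕ) ≠ n := fun h => hi (Fin.ext h)
      simp [cyclicBidiagonal_apply, hi, this]
  have h3 : ((cyclicBidiagonal (n + 1) a (0 : R)).updateRow (Fin.last n) (Pi.single 0 1)).det =
      (-1) ^ n := by
    rw [← Matrix.adjugate_apply, Matrix.adjugate_fin_succ_eq_det_submatrix,
      Matrix.det_of_isLowerTriangular]
    · have h4 : ∀ i : Fin n, ((cyclicBidiagonal (n + 1) a (0 : R)).submatrix
          (Fin.last n).succAbove (Fin.succAbove 0)) i i = 1 := by
        intro i
        simp [cyclicBidiagonal_apply]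
      simp only [h4]
      simp
    · intro i j hij
      have hij' : (i : ℕ) < j := hij
      simp only [Matrix.submatrix_apply, cyclicBidiagonal_apply, Fin.succAbove_last,
        Fin.succAbove_zero, Fin.val_castSucc, Fin.val_succ]
      rw [if_neg (by omega), if_neg (by omega)]
      simp
  rw [h1, Matrix.det_updateRow_add, Matrix.det_updateRow_smul, h3, Matrix.updateRow_eq_self,
    det_cyclicBidiagonal_zero]
  ring

end Matrices

/-! ### Right factors of `X_t - c` -/

section Factorizations

theorem xMatrix_eq_mul_rMatrix {R : Type*} [CommRing R] [Algebra ℂ R] {M : ℕ} (hM : 0 < M)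
    (K N : ℕ) (I V : ℤ → ℤ → ℂ) (t : ℤ) (y : R) :
    ∃ Y : Matrix (Fin N) (Fin N) R,
      xMatrix M K N I V t y = Y * rMatrix N I (t - (M - 1) * K) y := by
  obtain ⟨m, rfl⟩ : ∃ m, M = m + 1 := ⟨M - 1, by omega⟩
  refine ⟨((List.range K).reverse.map fun i : ℕ => lMatrix N V (t - i * (m + 1 : ℕ)) y).prod *
    (((List.range m).map fun j : ℕ => rMatrix N I (t - j * K) y).prod), ?_⟩
  rw [xMatrix_eq, List.range_succ, List.map_append, List.prod_append, mul_assoc]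
  simp

theorem lMatrix_mul_prod_rMatrix {R : Type*} [CommRing R] [Algebra ℂ R] {M K N : ℕ}
    {I V : ℤ → ℤ → ℂ} (h : IsPeriodicSolution M K N I V) (t : ℤ) (y : R) (m : ℕ) :
    lMatrix N V t y * ((List.range m).map fun j : ℕ => rMatrix N I (t - j * K) y).prod =
      ((List.range m).map fun j : ℕ => rMatrix N I (t - j * K - M) y).prod *
        lMatrix N V (t - m * K) y := by
  induction m with
  | zero => simp
  | succ m ih =>
    rw [List.range_succ, List.map_append, List.prod_append, List.map_append, List.prod_append,
      ← mul_assoc, ih]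
    simp only [List.map_cons, List.map_nil, List.prod_singleton]
    rw [mul_assoc, mul_assoc, lMatrix_mul_rMatrix h,
      show t - ((m + 1 : ℕ) : ℤ) * K = t - m * K - K by push_cast; ring]

/-- The rightmost `L` factor, `L_t`, is carried through all `M` factors `R`; each exchange lowers
its time by `K`. -/
theorem xMatrix_eq_mul_lMatrix {R : Type*} [CommRing R] [Algebra ℂ R] {M K N : ℕ} (hK : 0 < K)
    {I V : ℤ → ℤ → ℂ} (h : IsPeriodicSolution M K N I V) (t : ℤ) (y : R) :
    ∃ Y : Matrix (Fin N) (Fin N) R,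
      xMatrix M K N I V t y = Y * lMatrix N V (t - M * K) y := by
  obtain ⟨k, rfl⟩ : ∃ k, K = k + 1 := ⟨K - 1, by omega⟩
  refine ⟨(((List.range k).map Nat.succ).reverse.map fun i : ℕ => lMatrix N V (t - i * M) y).prod *
    ((List.range M).map fun j : ℕ => rMatrix N I (t - j * (k + 1 : ℕ) - M) y).prod, ?_⟩
  rw [xMatrix_eq, List.range_succ_eq_map, List.reverse_cons, List.map_append, List.prod_append]
  simp only [List.map_cons, List.map_nil, List.prod_singleton]
  rw [mul_assoc, mul_assoc, ← lMatrix_mul_prod_rMatrix h]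
  simp

theorem cyclicBidiagonal_mulVec_single {R : Type*} [CommRing R] [Algebra ℂ R] {N : ℕ}
    (hN : 0 < N) (a : ℤ → ℂ) :
    (cyclicBidiagonal N a (0 : R)).mulVec (Pi.single ⟨0, hN⟩ 1) =
      algebraMap ℂ R (a 1) • Pi.single ⟨0, hN⟩ 1 := by
  ext i
  rw [Matrix.mulVec_single_one, Matrix.col_apply, cyclicBidiagonal_apply, Pi.smul_apply]
  by_cases hi : i = ⟨0, hN⟩
  · subst hi; simp
  · have : (i : ℕ) ≠ 0 := fun h => hi (Fin.ext h)
    simp [this, hi]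

theorem list_prod_mulVec_single {R : Type*} [CommRing R] [Algebra ℂ R] {N : ℕ}
    (hN : 0 < N) (a : ℕ → ℤ → ℂ) (l : List ℕ) :
    (l.map fun i => cyclicBidiagonal N (a i) (0 : R)).prod.mulVec (Pi.single ⟨0, hN⟩ 1) =
      algebraMap ℂ R (l.map fun i => a i 1).prod • Pi.single ⟨0, hN⟩ 1 := by
  induction l with
  | nil => rw [List.map_nil, List.map_nil, List.prod_nil, List.prod_nil, Matrix.one_mulVec, map_one, one_smul]
  | cons i l ih =>
    simp only [List.map_cons, List.prod_cons]
    rw [← Matrix.mulVec_mulVec, ih, Matrix.mulVec_smul, cyclicBidiagonal_mulVec_single,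
      smul_smul, ← map_mul, mul_comm]

/-- At `y = 0` all factors are upper triangular, so the first basis vector is a common eigenvector
and the eigenvalues multiply. -/
theorem xMatrix_mulVec_single {R : Type*} [CommRing R] [Algebra ℂ R] {N : ℕ} (hN : 0 < N)
    (M K : ℕ) (I V : ℤ → ℤ → ℂ) (t : ℤ) :
    (xMatrix M K N I V t (0 : R)).mulVec (Pi.single ⟨0, hN⟩ 1) =
      algebraMap ℂ R (uOne M K I V t) • Pi.single ⟨0, hN⟩ 1 := by
  rw [xMatrix_eq, ← Matrix.mulVec_mulVec]
  simp only [lMatrix, rMatrix]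
  rw [list_prod_mulVec_single hN (fun (j : ℕ) n => I n (t - j * K)), Matrix.mulVec_smul,
    list_prod_mulVec_single hN (fun (j : ℕ) n => V n (t - j * M)), smul_smul, ← map_mul, uOne,
    List.map_reverse, List.prod_reverse]
  rw [mul_comm]
  simp [Finset.prod_eq_multiset_prod, Finset.range_val, Multiset.range]

/-- A matrix over `ℂ[y]` whose first column vanishes at `y = 0` is a left multiple of the shift
matrix. -/
theorem exists_eq_mul_shiftMatrix {N : ℕ} (hN : 0 < N) (Z : Matrix (Fin N) (Fin N) ℂ[X])
    (hZ : ∀ i, (Z i ⟨0, hN⟩).eval 0 = 0) :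
    ∃ Y : Matrix (Fin N) (Fin N) ℂ[X], Z = Y * shiftMatrix N (X : ℂ[X]) := by
  -- Right multiplication by `S` moves columns one place to the right and brings the last one to the
  -- front times `y`; this witness undoes that, with `divX` for the division by `y`.
  refine ⟨Matrix.of fun i j => if h : (j : ℕ) + 1 < N then Z i ⟨j + 1, h⟩ else
    (Z i ⟨0, hN⟩).divX, ?_⟩
  ext1 i j
  rw [Matrix.mul_apply]
  by_cases hj : (j : ℕ) = 0
  · obtain rfl : j = ⟨0, hN⟩ := Fin.ext hj
    rw [Finset.sum_eq_single ⟨N - 1, by omega⟩]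
    · have h0 : (Z i ⟨0, hN⟩).coeff 0 = 0 := by rw [coeff_zero_eq_eval_zero, hZ]
      have h1 := (Z i ⟨0, hN⟩).divX_mul_X_add
      rw [h0, C_0, add_zero] at h1
      have h2 : N - 1 + 1 = N := by omega
      simp [shiftMatrix, cyclicBidiagonal_apply, h2, h1, hN.ne']
    · intro k _ hk
      have : (k : ℕ) + 1 ≠ N := fun h => hk (Fin.ext (by simp; omega))
      simp [shiftMatrix, cyclicBidiagonal_apply, this]
    · simp
  · rw [Finset.sum_eq_single ⟨j - 1, by omega⟩]
    · have h2 : (j : ℕ) - 1 + 1 = j := by omega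
      simp [shiftMatrix, cyclicBidiagonal_apply, h2, hj]
    · intro k _ hk
      have : (k : ℕ) + 1 ≠ j := fun h => hk (Fin.ext (by simp; omega))
      simp [shiftMatrix, cyclicBidiagonal_apply, this, hj]
    · simp

theorem xMatrix_sub_eq_mul_shiftMatrix {N : ℕ} (hN : 0 < N) (M K : ℕ) (I V : ℤ → ℤ → ℂ) (t : ℤ) :
    ∃ Y : Matrix (Fin N) (Fin N) ℂ[X],
      xMatrix M K N I V t (X : ℂ[X]) - Matrix.scalar _ (C (uOne M K I V t)) =
        Y * shiftMatrix N (X : ℂ[X]) := by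
  apply exists_eq_mul_shiftMatrix hN
  intro i
  have h1 := congr_fun (xMatrix_mulVec_single (R := ℂ) hN M K I V t) i
  rw [Matrix.mulVec_single_one, Matrix.col_apply] at h1
  have h2 := congr_fun (congr_fun (xMatrix_map (aeval (0 : ℂ)) M K N I V t X) i) ⟨0, hN⟩
  rw [aeval_X, h1, AlgHom.mapMatrix_apply, Matrix.map_apply, coe_aeval_eq_eval] at h2
  rw [Matrix.sub_apply, eval_sub, h2]
  by_cases hi : i = ⟨0, hN⟩
  · subst hi; simp
  · simp [hi]

end Factorizations

/-! ### Eigenspaces at smooth points are lines -/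

section Corank

/-- If the value of a matrix of polynomials at `a` kills two independent vectors, then its
determinant vanishes doubly at `a`. -/
theorem sq_dvd_det_of_mulVec_eq_zero {n : Type*} [Fintype n] [DecidableEq n]
    (B : Matrix n n ℂ[X]) (a : ℂ) (u v : n → ℂ) {i j : n} (hij : i ≠ j)
    (hui : u i = 1) (hvi : v i = 0) (hvj : v j = 1)
    (hu : (B.map (eval a)).mulVec u = 0) (hv : (B.map (eval a)).mulVec v = 0) :
    (X - C a) ^ 2 ∣ B.det := by
  have key : ∀ z : n → ℂ, (B.map (eval a)).mulVec z = 0 →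
      ∃ q : n → ℂ[X], B.mulVec (fun k => C (z k)) = (X - C a) • q := by
    intro z hz
    have : ∀ k, ∃ q : ℂ[X], B.mulVec (fun k => C (z k)) k = (X - C a) * q := by
      intro k
      apply dvd_iff_isRoot.2
      have h := congr_fun hz k
      simp only [Matrix.mulVec, dotProduct, Matrix.map_apply, Pi.zero_apply] at h
      simpa [IsRoot, Matrix.mulVec, dotProduct, eval_finsetSum] using h
    choose q hq using this
    exact ⟨q, funext hq⟩
  -- Cramer's rule: replacing column `k` by `A z` multiplies the determinant by `z k`. Applied to
  -- `u` and then `v`, it leaves `det B` unchanged and creates two columns divisible by `X - a`.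
  have step : ∀ (A : Matrix n n ℂ[X]) (z : n → ℂ[X]) (k : n),
      (A.updateCol k (A.mulVec z)).det = A.det * z k := by
    intro A z k
    rw [← Matrix.cramer_apply, Matrix.cramer_eq_adjugate_mulVec, Matrix.mulVec_mulVec,
      Matrix.adjugate_mul, Matrix.smul_mulVec, Matrix.one_mulVec]
    rfl
  obtain ⟨p, hp⟩ := key u hu
  obtain ⟨q, hq⟩ := key v hv
  have h1 := step B (fun k => C (u k)) i
  simp only [hui, C_1, mul_one] at h1
  have h2 := step (B.updateCol i (B.mulVec fun k => C (u k))) (fun k => C (v k)) j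
  simp only [hvj, C_1, mul_one] at h2
  -- Since `v i = 0`, the column already replaced does not contribute.
  have h3 : (B.updateCol i (B.mulVec fun k => C (u k))).mulVec (fun k => C (v k)) =
      B.mulVec fun k => C (v k) := by
    ext1 k
    simp only [Matrix.mulVec, dotProduct]
    refine Finset.sum_congr rfl fun l _ => ?_
    by_cases hl : l = i
    · subst hl; simp [hvi]
    · rw [Matrix.updateCol_ne hl]
  rw [h1, h3, hq, Matrix.det_updateCol_smul, Matrix.updateCol_comm _ hij, hp,
    Matrix.det_updateCol_smul] at h2
  exact ⟨_, by rw [← h2, sq, mul_assoc]⟩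

theorem exists_eq_smul_of_mulVec_eq_zero {n : Type*} [Fintype n] [DecidableEq n]
    (B : Matrix n n ℂ[X]) (a : ℂ) (u v : n → ℂ) (hu0 : u ≠ 0)
    (hu : (B.map (eval a)).mulVec u = 0) (hv : (B.map (eval a)).mulVec v = 0)
    (hB : (derivative B.det).eval a ≠ 0) : ∃ c : ℂ, v = c • u := by
  obtain ⟨i, hi⟩ := Function.ne_iff.1 hu0
  by_contra hcon
  obtain ⟨j, hj⟩ : ∃ j, u i * v j - u j * v i ≠ 0 := by
    by_contra! h
    refine hcon ⟨v i / u i, funext fun j => ?_⟩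
    have := h j
    simp only [Pi.zero_apply] at hi
    simp only [Pi.smul_apply, smul_eq_mul]
    field_simp
    linear_combination this
  set d := u i * v j - u j * v i with hd
  have hij : i ≠ j := by
    rintro rfl
    exact hj (by rw [hd]; ring)
  -- The combinations of `u` and `v` whose coordinates at `i`, `j` are `(1, 0)` and `(0, 1)`; `d` is
  -- the nonzero minor.
  obtain ⟨q, hq⟩ := sq_dvd_det_of_mulVec_eq_zero B a (d⁻¹ • (v j • u - u j • v))
    (d⁻¹ • (u i • v - v i • u)) hij
    (by simp only [Pi.smul_apply, Pi.sub_apply, smul_eq_mul]; rw [inv_mul_eq_one₀ hj, hd]; ring)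
    (by simp only [Pi.smul_apply, Pi.sub_apply, smul_eq_mul]; ring)
    (by simp only [Pi.smul_apply, Pi.sub_apply, smul_eq_mul]; rw [inv_mul_eq_one₀ hj, hd]; ring)
    (by simp [Matrix.mulVec_smul, Matrix.mulVec_sub, hu, hv])
    (by simp [Matrix.mulVec_smul, Matrix.mulVec_sub, hu, hv])
  apply hB
  rw [hq, sq, mul_assoc, derivative_mul]
  simp

/-- At a smooth point of the spectral curve of `A` the eigenspace is a line. -/
theorem exists_eq_smul_of_smooth {n : Type*} [Fintype n] [DecidableEq n]
    (A : Matrix n n ℂ[X]) (x₀ y₀ : ℂ)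
    (hsm : (derivative (A.charpoly.map (evalRingHom y₀))).eval x₀ ≠ 0 ∨
      (derivative (A.charpoly.eval (C x₀))).eval y₀ ≠ 0)
    (u v : n → ℂ) (hu0 : u ≠ 0)
    (hu : (A.map (eval y₀)).mulVec u = x₀ • u) (hv : (A.map (eval y₀)).mulVec v = x₀ • v) :
    ∃ c : ℂ, v = c • u := by
  -- The corank bound is applied to `x - A(y₀)` as a pencil in `x`, or to `x₀ - A(y)` as a matrix
  -- polynomial in `y`, according to the partial derivative that survives.
  rcases hsm with h | h
  · rw [← Matrix.charpoly_map] at h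
    have e : ((A.map (evalRingHom y₀)).charmatrix).map (eval x₀) =
        Matrix.scalar n x₀ - A.map (eval y₀) := by
      ext i j
      by_cases hij : i = j
      · subst hij; simp
      · simp [hij]
    refine exists_eq_smul_of_mulVec_eq_zero _ x₀ u v hu0 ?_ ?_ h
    · rw [e, Matrix.sub_mulVec, hu, Matrix.scalar_apply, ← Matrix.smul_one_eq_diagonal,
        Matrix.smul_mulVec, Matrix.one_mulVec, sub_self]
    · rw [e, Matrix.sub_mulVec, hv, Matrix.scalar_apply, ← Matrix.smul_one_eq_diagonal,
        Matrix.smul_mulVec, Matrix.one_mulVec, sub_self]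
  · rw [Matrix.eval_charpoly] at h
    have e : (Matrix.scalar n (C x₀) - A).map (eval y₀) =
        Matrix.scalar n x₀ - A.map (eval y₀) := by
      ext i j
      by_cases hij : i = j
      · subst hij; simp
      · simp [hij]
    refine exists_eq_smul_of_mulVec_eq_zero _ y₀ u v hu0 ?_ ?_ h
    · rw [e, Matrix.sub_mulVec, hu, Matrix.scalar_apply, ← Matrix.smul_one_eq_diagonal,
        Matrix.smul_mulVec, Matrix.one_mulVec, sub_self]
    · rw [e, Matrix.sub_mulVec, hv, Matrix.scalar_apply, ← Matrix.smul_one_eq_diagonal,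
        Matrix.smul_mulVec, Matrix.one_mulVec, sub_self]

end Corank

/-! ### Orders of vectors at finite places -/

section Valuations

variable {𝕂 : Type*} [CommRing 𝕂] {N : ℕ} (w : AddValuation 𝕂 (WithTop ℤ))

/-- The minimum of the valuations of the components of a vector. -/
def vecMin (v : Fin N → 𝕂) : WithTop ℤ :=
  Finset.univ.inf fun i => w (v i)

theorem le_vecMin_iff {v : Fin N → 𝕂} {m : WithTop ℤ} : m ≤ vecMin w v ↔ ∀ i, m ≤ w (v i) := by
  simp [vecMin]

theorem vecMin_le (v : Fin N → 𝕂) (i : Fin N) : vecMin w v ≤ w (v i) :=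
  (le_vecMin_iff w).1 le_rfl i

theorem exists_vecMin_eq (hN : 0 < N) (v : Fin N → 𝕂) : ∃ i, vecMin w v = w (v i) := by
  obtain ⟨i, -, hi⟩ := Finset.exists_mem_eq_inf (Finset.univ : Finset (Fin N)) ⟨⟨0, hN⟩, Finset.mem_univ _⟩
    fun i => w (v i)
  exact ⟨i, hi⟩

theorem vecMin_smul (hN : 0 < N) (c : 𝕂) (v : Fin N → 𝕂) :
    vecMin w (c • v) = w c + vecMin w v := by
  apply le_antisymm
  · obtain ⟨i, hi⟩ := exists_vecMin_eq w hN v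
    rw [hi, ← w.map_mul]
    exact vecMin_le w (c • v) i
  · rw [le_vecMin_iff]
    intro i
    rw [Pi.smul_apply, smul_eq_mul, w.map_mul]
    gcongr
    exact vecMin_le w v i

theorem vecMin_le_mulVec {B : Matrix (Fin N) (Fin N) 𝕂} (hB : ∀ i j, 0 ≤ w (B i j))
    (v : Fin N → 𝕂) : vecMin w v ≤ vecMin w (B.mulVec v) := by
  rw [le_vecMin_iff]
  intro i
  rw [Matrix.mulVec, dotProduct]
  refine w.map_le_sum fun j _ => ?_
  rw [w.map_mul]
  exact (vecMin_le w v j).trans (le_add_of_nonneg_left (hB i j))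

variable [Algebra ℂ 𝕂]

theorem map_const_nonneg (hw : ∀ c : ℂ, c ≠ 0 → w (algebraMap ℂ 𝕂 c) = 0) (c : ℂ) :
    0 ≤ w (algebraMap ℂ 𝕂 c) := by
  by_cases hc : c = 0
  · simp [hc]
  · rw [hw c hc]

theorem map_aeval_nonneg (hw : ∀ c : ℂ, c ≠ 0 → w (algebraMap ℂ 𝕂 c) = 0) {y : 𝕂}
    (hy : 0 ≤ w y) (q : ℂ[X]) : 0 ≤ w (aeval y q) := by
  rw [aeval_eq_sum_range]
  refine w.map_le_sum fun i _ => ?_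
  rw [Algebra.smul_def, w.map_mul, w.map_pow]
  exact add_nonneg (map_const_nonneg w hw _) (nsmul_nonneg hy _)

theorem map_aeval_sub_pos (hw : ∀ c : ℂ, c ≠ 0 → w (algebraMap ℂ 𝕂 c) = 0) {y : 𝕂} {y₀ : ℂ}
    (hy : 0 < w (y - algebraMap ℂ 𝕂 y₀)) (q : ℂ[X]) :
    0 < w (aeval y q - algebraMap ℂ 𝕂 (q.eval y₀)) := by
  have hy0 : 0 ≤ w y := by
    have := w.map_le_add hy.le (map_const_nonneg w hw y₀)
    rwa [sub_add_cancel] at this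
  obtain ⟨r, hr⟩ := X_sub_C_dvd_sub_C_eval (p := q) (a := y₀)
  have h : aeval y q - algebraMap ℂ 𝕂 (q.eval y₀) = (y - algebraMap ℂ 𝕂 y₀) * aeval y r := by
    have := congr_arg (aeval y) hr
    simpa using this
  rw [h, w.map_mul]
  exact add_pos_of_pos_of_nonneg hy (map_aeval_nonneg w hw hy0 r)

theorem mulVec_mulVec_eq_sub_smul {x y : 𝕂} {A Y T : Matrix (Fin N) (Fin N) ℂ[X]} {c : ℂ}
    (hA : A - Matrix.scalar _ (C c) = Y * T) {v : Fin N → 𝕂}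
    (hv : ((aeval y).mapMatrix A).mulVec v = x • v) :
    ((aeval y).mapMatrix Y).mulVec (((aeval y).mapMatrix T).mulVec v) =
      (x - algebraMap ℂ 𝕂 c) • v := by
  rw [Matrix.mulVec_mulVec, ← map_mul, ← hA, map_sub, Matrix.sub_mulVec, hv, sub_smul]
  congr 1
  have : (aeval y).mapMatrix (Matrix.scalar (Fin N) (C c)) =
      algebraMap ℂ 𝕂 c • (1 : Matrix (Fin N) (Fin N) 𝕂) := by
    rw [Matrix.scalar_apply, AlgHom.mapMatrix_apply, Matrix.diagonal_map (map_zero _),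
      Matrix.smul_one_eq_diagonal]
    simp
  rw [this, Matrix.smul_mulVec, Matrix.one_mulVec]

theorem vecMin_le_vecMin_mulVec (hw : ∀ c : ℂ, c ≠ 0 → w (algebraMap ℂ 𝕂 c) = 0)
    {y : 𝕂} (hy : 0 ≤ w y) (T : Matrix (Fin N) (Fin N) ℂ[X]) (v : Fin N → 𝕂) :
    vecMin w v ≤ vecMin w (((aeval y).mapMatrix T).mulVec v) :=
  vecMin_le_mulVec w (fun _ _ => map_aeval_nonneg w hw hy _) v

/-- The adjugate, whose entries are regular, recovers `det T • v` from `T v`. -/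
theorem vecMin_mulVec_le_det (hw : ∀ c : ℂ, c ≠ 0 → w (algebraMap ℂ 𝕂 c) = 0) (hN : 0 < N)
    {y : 𝕂} (hy : 0 ≤ w y) (T : Matrix (Fin N) (Fin N) ℂ[X]) (v : Fin N → 𝕂) :
    vecMin w (((aeval y).mapMatrix T).mulVec v) ≤ w (aeval y T.det) + vecMin w v := by
  have h : ((aeval y).mapMatrix T.adjugate).mulVec (((aeval y).mapMatrix T).mulVec v) =
      aeval y T.det • v := by
    rw [Matrix.mulVec_mulVec, AlgHom.map_adjugate, Matrix.adjugate_mul, AlgHom.map_det,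
      Matrix.smul_mulVec, Matrix.one_mulVec]
  rw [← vecMin_smul w hN, ← h]
  exact vecMin_le_vecMin_mulVec w hw hy _ _

/-- The cofactor `Y`, whose entries are regular, recovers `(x - c) • v` from `T v`. -/
theorem vecMin_mulVec_le_sub (hw : ∀ c : ℂ, c ≠ 0 → w (algebraMap ℂ 𝕂 c) = 0) (hN : 0 < N)
    {x y : 𝕂} (hy : 0 ≤ w y) {A Y T : Matrix (Fin N) (Fin N) ℂ[X]} {c : ℂ}
    (hA : A - Matrix.scalar _ (C c) = Y * T) {v : Fin N → 𝕂}
    (hv : ((aeval y).mapMatrix A).mulVec v = x • v) :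
    vecMin w (((aeval y).mapMatrix T).mulVec v) ≤ w (x - algebraMap ℂ 𝕂 c) + vecMin w v := by
  rw [← vecMin_smul w hN, ← mulVec_mulVec_eq_sub_smul hA hv]
  exact vecMin_le_vecMin_mulVec w hw hy _ _

/-- Residues of a matrix-vector product. -/
theorem mulVec_sub_pos (hw : ∀ c : ℂ, c ≠ 0 → w (algebraMap ℂ 𝕂 c) = 0) {y : 𝕂} {y₀ : ℂ}
    (hy : 0 < w (y - algebraMap ℂ 𝕂 y₀)) {v : Fin N → 𝕂} {u : Fin N → ℂ} (hv : ∀ i, 0 ≤ w (v i))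
    (hu : ∀ i, 0 < w (v i - algebraMap ℂ 𝕂 (u i))) (T : Matrix (Fin N) (Fin N) ℂ[X]) (i : Fin N) :
    0 < w (((aeval y).mapMatrix T).mulVec v i -
      algebraMap ℂ 𝕂 ((T.map (eval y₀)).mulVec u i)) := by
  rw [Matrix.mulVec, Matrix.mulVec, dotProduct, dotProduct, map_sum, ← Finset.sum_sub_distrib]
  refine w.map_lt_sum' (WithTop.coe_lt_top 0) fun j _ => ?_
  rw [map_mul, AlgHom.mapMatrix_apply, Matrix.map_apply, Matrix.map_apply,
    show ∀ a b c d : 𝕂, a * b - c * d = (a - c) * b + c * (b - d) by intros; ring]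
  refine w.map_lt_add ?_ ?_
  · rw [w.map_mul]
    exact add_pos_of_pos_of_nonneg (map_aeval_sub_pos w hw hy _) (hv j)
  · rw [w.map_mul, add_comm]
    exact add_pos_of_pos_of_nonneg (hu j) (map_const_nonneg w hw _)

theorem eq_zero_of_map_const_pos (hw : ∀ c : ℂ, c ≠ 0 → w (algebraMap ℂ 𝕂 c) = 0) {c : ℂ}
    (hc : 0 < w (algebraMap ℂ 𝕂 c)) : c = 0 := by
  by_contra h
  rw [hw c h] at hc
  exact lt_irrefl _ hc

theorem nonneg_of_sub_pos (hw : ∀ c : ℂ, c ≠ 0 → w (algebraMap ℂ 𝕂 c) = 0) {y : 𝕂} {y₀ : ℂ}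
    (hy : 0 < w (y - algebraMap ℂ 𝕂 y₀)) : 0 ≤ w y := by
  have := w.map_le_add hy.le (map_const_nonneg w hw y₀)
  rwa [sub_add_cancel] at this

/-- After scaling `v` to order zero, its residue is an eigenvector of `A(y₀)`. By `hline` it is a
multiple of a kernel vector of `T(y₀)`, so every component of `T v` has zero residue. -/
theorem vecMin_add_one_le (hw : ∀ c : ℂ, c ≠ 0 → w (algebraMap ℂ 𝕂 c) = 0) (hN : 0 < N)
    (hres : ∀ f, 0 ≤ w f → ∃ c : ℂ, 0 < w (f - algebraMap ℂ 𝕂 c))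
    (hsurj : Function.Surjective w) {x y : 𝕂} {x₀ y₀ : ℂ} (hx : 0 < w (x - algebraMap ℂ 𝕂 x₀))
    (hy : 0 < w (y - algebraMap ℂ 𝕂 y₀)) {A Y T : Matrix (Fin N) (Fin N) ℂ[X]}
    (hA : A - Matrix.scalar _ (C x₀) = Y * T) {v : Fin N → 𝕂}
    (hv : ((aeval y).mapMatrix A).mulVec v = x • v) (hv0 : vecMin w v ≠ ⊤)
    (hdet : (T.map (eval y₀)).det = 0)
    (hline : ∀ u u' : Fin N → ℂ, u ≠ 0 → (A.map (eval y₀)).mulVec u = x₀ • u →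
      (A.map (eval y₀)).mulVec u' = x₀ • u' → ∃ c : ℂ, u' = c • u) :
    vecMin w v + (1 : ℤ) ≤ vecMin w (((aeval y).mapMatrix T).mulVec v) := by
  obtain ⟨m, hm⟩ := WithTop.ne_top_iff_exists.1 hv0
  obtain ⟨g, hg⟩ := hsurj ((-m : ℤ) : WithTop ℤ)
  have hg0 : vecMin w (g • v) = 0 := by
    rw [vecMin_smul w hN, hg, ← hm, ← WithTop.coe_add, neg_add_cancel]; rfl
  have hz : ∀ i, 0 ≤ w ((g • v) i) := (le_vecMin_iff w).1 hg0.ge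
  choose u hu using fun i => hres _ (hz i)
  have hAy : (A.map (eval y₀)).mulVec u = x₀ • u := by
    ext i
    have h1 := mulVec_sub_pos w hw hy hz hu A i
    rw [Matrix.mulVec_smul, hv] at h1
    have h2 : 0 < w ((x - algebraMap ℂ 𝕂 x₀) * (g • v) i + algebraMap ℂ 𝕂 x₀ *
        ((g • v) i - algebraMap ℂ 𝕂 (u i))) := by
      refine w.map_lt_add ?_ ?_
      · rw [w.map_mul]
        exact add_pos_of_pos_of_nonneg hx (hz i)
      · rw [w.map_mul, add_comm]
        exact add_pos_of_pos_of_nonneg (hu i) (map_const_nonneg w hw _)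
    have h3 := lt_of_lt_of_le (lt_min h2 h1) (w.map_sub _ _)
    rw [← sub_eq_zero]
    apply eq_zero_of_map_const_pos w hw
    convert h3 using 2
    simp only [Pi.smul_apply, smul_eq_mul, map_sub, map_mul]
    ring
  -- The kernel of `T(y₀)` lies in the eigenspace because `T` is a right factor of `A - x₀`.
  obtain ⟨k, hk0, hk⟩ := Matrix.exists_mulVec_eq_zero_iff.2 hdet
  have hkA : (A.map (eval y₀)).mulVec k = x₀ • k := by
    have h1 := congr_arg (fun Z => ((evalRingHom y₀).mapMatrix Z).mulVec k) hA
    simp only [map_sub, map_mul, RingHom.mapMatrix_apply, coe_evalRingHom] at h1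
    rw [← Matrix.mulVec_mulVec, hk, Matrix.mulVec_zero, Matrix.sub_mulVec, sub_eq_zero] at h1
    rw [h1, Matrix.scalar_apply, Matrix.diagonal_map eval_zero, eval_C,
      ← Matrix.smul_one_eq_diagonal, Matrix.smul_mulVec, Matrix.one_mulVec]
  obtain ⟨c, rfl⟩ := hline k u hk0 hkA hAy
  have hT : (T.map (eval y₀)).mulVec (c • k) = 0 := by rw [Matrix.mulVec_smul, hk, smul_zero]
  have h1 : (1 : ℤ) ≤ vecMin w (((aeval y).mapMatrix T).mulVec (g • v)) := by
    rw [le_vecMin_iff]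
    intro i
    have h2 := mulVec_sub_pos w hw hy hz hu T i
    rw [hT, Pi.zero_apply, map_zero, sub_zero] at h2
    generalize w _ = a at h2 ⊢
    cases a with
    | top => exact le_top
    | coe a => exact WithTop.coe_le_coe.2 (WithTop.coe_lt_coe.1 h2)
  rw [Matrix.mulVec_smul, vecMin_smul w hN, hg] at h1
  rw [← hm]
  generalize vecMin w _ = a at h1 ⊢
  cases a with
  | top => exact le_top
  | coe a =>
    rw [← WithTop.coe_add] at h1 ⊢
    rw [WithTop.coe_le_coe] at h1 ⊢
    omega

end Valuations
-- Orders of the components of an eigenvector at infinity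
theorem mem_of_add_mem_iff {n k : ℕ} (hk : Nat.Coprime k (n + 1)) {J : Set (ZMod (n + 1))}
    (h : ∀ i, i ∈ J ↔ i + k • (1 : ZMod (n + 1)) ∈ J) {i : ZMod (n + 1)} (hi : i ∈ J)
    (j : ZMod (n + 1)) : j ∈ J := by
  have h1 : ∀ r : ℕ, i + (r * k : ZMod (n + 1)) ∈ J := by
    intro r
    induction r with
    | zero => simpa using hi
    | succ r ih =>
      rw [h, nsmul_one] at ih
      convert ih using 1
      push_cast
      ring
  have h2 := h1 ((j - i) * (k : ZMod (n + 1))⁻¹).val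
  rwa [ZMod.natCast_zmod_val, mul_assoc, mul_comm _ (k : ZMod (n + 1)),
    ZMod.coe_mul_inv_eq_one k hk, mul_one, add_sub_cancel] at h2

theorem eq_univ_of_add_mem_iff {n k : ℕ} (hk : Nat.Coprime k (n + 1)) {J : Set (Fin (n + 1))}
    (hJ : J.Nonempty) (h : J = {i | i + k • (1 : Fin (n + 1)) ∈ J}) : J = Set.univ := by
  obtain ⟨i, hi⟩ := hJ
  have h' : ∀ i, i ∈ J ↔ i + k • (1 : Fin (n + 1)) ∈ J := fun i => Set.ext_iff.1 h i
  exact Set.eq_univ_of_forall fun j => mem_of_add_mem_iff hk h' hi j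

section Infinity

variable {𝕂 : Type*} [CommRing 𝕂] {n : ℕ} (w : AddValuation 𝕂 (WithTop ℤ))

/-- The slope-corrected minimum of the valuations of the components of `u` is `m`, and it is
attained exactly at the indices in `J`. -/
def IsProfile (b : ℤ) (u : Fin (n + 1) → 𝕂) (m : ℤ) (J : Set (Fin (n + 1))) : Prop :=
  ∀ i, (i ∈ J → w (u i) = ((m - b * (i : ℕ) : ℤ) : WithTop ℤ)) ∧
    (i ∉ J → ((m - b * (i : ℕ) : ℤ) : WithTop ℤ) < w (u i))

variable {w}

theorem IsProfile.smul {b : ℤ} {u : Fin (n + 1) → 𝕂} {m : ℤ} {J : Set (Fin (n + 1))}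
    (h : IsProfile w b u m J) {x : 𝕂} {k : ℤ} (hx : w x = k) :
    IsProfile w b (x • u) (m + k) J := by
  intro i
  rw [Pi.smul_apply, smul_eq_mul, w.map_mul, hx, show m + k - b * (i : ℕ) = k + (m - b * (i : ℕ)) by ring,
    WithTop.coe_add]
  refine ⟨fun hi => by rw [(h i).1 hi], fun hi => ?_⟩
  have h2 := (h i).2 hi
  generalize w _ = z at h2 ⊢
  cases z with
  | top =>
      rw [add_top, ← WithTop.coe_add]
      exact WithTop.coe_lt_top _
  | coe z =>
    rw [← WithTop.coe_add, ← WithTop.coe_add]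
    rw [WithTop.coe_lt_coe] at h2 ⊢
    omega

theorem IsProfile.le {b : ℤ} {u : Fin (n + 1) → 𝕂} {m m' : ℤ} {J J' : Set (Fin (n + 1))}
    (h : IsProfile w b u m J) (h' : IsProfile w b u m' J') (hJ' : J'.Nonempty) : m ≤ m' := by
  obtain ⟨i, hi⟩ := hJ'
  have h1 := (h' i).1 hi
  have h2 : ((m - b * (i : ℕ) : ℤ) : WithTop ℤ) ≤ w (u i) := by
    by_cases hi : i ∈ J
    · exact ((h i).1 hi).ge
    · exact ((h i).2 hi).le
  rw [h1, WithTop.coe_le_coe] at h2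
  omega

/-- This allows the profile of `x • u` to be compared with that of `X_t u` for an eigenvector `u`.
-/
theorem IsProfile.unique {b : ℤ} {u : Fin (n + 1) → 𝕂} {m m' : ℤ} {J J' : Set (Fin (n + 1))}
    (h : IsProfile w b u m J) (h' : IsProfile w b u m' J') (hJ : J.Nonempty) (hJ' : J'.Nonempty) :
    m = m' ∧ J = J' := by
  obtain rfl := le_antisymm (h.le h' hJ') (h'.le h hJ)
  refine ⟨rfl, Set.ext fun i => ⟨fun hi => ?_, fun hi => ?_⟩⟩
  · by_contra hi'
    exact ((h' i).2 hi').ne' ((h i).1 hi)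
  · by_contra hi'
    exact ((h i).2 hi').ne' ((h' i).1 hi)

theorem exists_isProfile (hw0 : ∀ f, f ≠ 0 → w f ≠ ⊤) (b : ℤ) {u : Fin (n + 1) → 𝕂} (hu : u ≠ 0) :
    ∃ (m : ℤ) (J : Set (Fin (n + 1))), J.Nonempty ∧ IsProfile w b u m J := by
  obtain ⟨i, -, hi⟩ := Finset.exists_min_image Finset.univ
    (fun i : Fin (n + 1) => w (u i) + ((b * (i : ℕ) : ℤ) : WithTop ℤ)) Finset.univ_nonempty
  have hfin : w (u i) ≠ ⊤ := by
    intro h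
    obtain ⟨j, hj⟩ := Function.ne_iff.1 hu
    have h1 := hi j (Finset.mem_univ _)
    rw [h, top_add, top_le_iff, WithTop.add_eq_top] at h1
    exact h1.elim (hw0 _ hj) WithTop.coe_ne_top
  obtain ⟨k, hk⟩ := WithTop.ne_top_iff_exists.1 hfin
  refine ⟨k + b * (i : ℕ), {j | w (u j) = ((k + b * (i : ℕ) - b * (j : ℕ) : ℤ) : WithTop ℤ)},
    ⟨i, ?_⟩, fun j => ⟨fun hj => hj, fun hj => ?_⟩⟩
  · rw [Set.mem_ofPred_eq, ← hk]; congr 1; ring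
  · refine lt_of_le_of_ne ?_ (Ne.symm hj)
    have h1 := hi j (Finset.mem_univ _)
    rw [← hk] at h1
    generalize w (u j) = z at h1 ⊢
    cases z with
    | top => exact le_top
    | coe z =>
      rw [← WithTop.coe_add, ← WithTop.coe_add] at h1
      rw [WithTop.coe_le_coe] at h1 ⊢
      omega

/-- With slope one and all indices attained, the orders decrease along the vector, so the last
component has the minimum. -/
theorem IsProfile.vecMin_eq {u : Fin (n + 1) → 𝕂} {m : ℤ} (h : IsProfile w 1 u m Set.univ) :
    vecMin w u = ((m - n : ℤ) : WithTop ℤ) := by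
  apply le_antisymm
  · refine (vecMin_le w u (Fin.last n)).trans (((h (Fin.last n)).1 (Set.mem_univ _)).le.trans ?_)
    simp
  · rw [le_vecMin_iff]
    intro i
    rw [(h i).1 (Set.mem_univ _), WithTop.coe_le_coe]
    omega

variable [Algebra ℂ 𝕂]

theorem cyclicBidiagonal_mulVec_apply (a : ℤ → ℂ) (y : 𝕂) (u : Fin (n + 1) → 𝕂) (i : Fin (n + 1)) :
    (cyclicBidiagonal (n + 1) a y).mulVec u i =
      algebraMap ℂ 𝕂 (a ((i : ℕ) + 1)) * u i + (if i = Fin.last n then y else 1) * u (i + 1) := by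
  have hterm : ∀ j, cyclicBidiagonal (n + 1) a y i j * u j =
      (if j = i then algebraMap ℂ 𝕂 (a ((i : ℕ) + 1)) * u i else 0) +
      (if j = i + 1 then (if i = Fin.last n then y else 1) * u (i + 1) else 0) := by
    intro j
    rw [cyclicBidiagonal_apply]
    have hval := Fin.val_add_one i
    have h1 : (j = i + 1) ↔ (j : ℕ) = if i = Fin.last n then 0 else (i : ℕ) + 1 := by
      rw [Fin.ext_iff, hval]
    have h2 : (i = Fin.last n) ↔ (i : ℕ) = n := by rw [Fin.ext_iff, Fin.val_last]
    have hj := j.isLt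
    rw [add_assoc, add_mul]
    congr 1
    · by_cases h : j = i
      · subst h; simp
      · have : (i : ℕ) ≠ j := fun e => h (Fin.ext e.symm)
        simp [h, this]
    · by_cases hi : i = Fin.last n
      · have hi' := h2.1 hi
        rw [if_neg (by omega)]
        by_cases h : j = i + 1
        · have hj0 := h1.1 h
          rw [if_pos hi] at hj0
          rw [if_pos ⟨by omega, hj0⟩, if_pos h, if_pos hi, zero_add, h]
        · have hj0 := mt h1.2 h
          rw [if_pos hi] at hj0
          rw [if_neg (by omega), if_neg h]; simp
      · have hi' := mt h2.2 hi
        rw [if_neg (c := (i : ℕ) + 1 = n + 1 ∧ (j : ℕ) = 0) (by omega)]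
        by_cases h : j = i + 1
        · have hj0 := h1.1 h
          rw [if_neg hi] at hj0
          rw [if_pos (by omega), if_pos h, if_neg hi, h, add_zero]
        · have hj0 := mt h1.2 h
          rw [if_neg hi] at hj0
          rw [if_neg (by omega), if_neg h]; simp
  rw [Matrix.mulVec, dotProduct, Finset.sum_congr rfl fun j _ => hterm j, Finset.sum_add_distrib,
    Finset.sum_ite_eq', Finset.sum_ite_eq']
  simp

/-- As `b > 0`, the shift term strictly beats the diagonal term. Passing from component `i + 1` to
`i` costs `b`; at the wrap-around from the first component to the last, the pole of `y` of order `(n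
+ 1) b` supplies the same loss. -/
theorem IsProfile.mulVec (hw : ∀ c : ℂ, c ≠ 0 → w (algebraMap ℂ 𝕂 c) = 0) {b : ℤ} (hb : 0 < b)
    {y : 𝕂} (hy : w y = ((-((n + 1 : ℕ) * b) : ℤ) : WithTop ℤ)) {u : Fin (n + 1) → 𝕂} {m : ℤ}
    {J : Set (Fin (n + 1))} (h : IsProfile w b u m J) (a : ℤ → ℂ) :
    IsProfile w b ((cyclicBidiagonal (n + 1) a y).mulVec u) (m - b) {i | i + 1 ∈ J} := by
  intro i
  rw [cyclicBidiagonal_mulVec_apply]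
  have h1 : ((m - b - b * (i : ℕ) : ℤ) : WithTop ℤ) <
      w (algebraMap ℂ 𝕂 (a ((i : ℕ) + 1)) * u i) := by
    rw [w.map_mul]
    refine lt_of_lt_of_le (WithTop.coe_lt_coe.2 (?_ : _ < m - b * (i : ℕ))) ?_
    · omega
    · refine le_trans ?_ (le_add_of_nonneg_left (map_const_nonneg w hw _))
      by_cases hi : i ∈ J
      · exact ((h i).1 hi).ge
      · exact ((h i).2 hi).le
  have hκ : ∃ κ : ℤ, w (if i = Fin.last n then y else 1) = κ ∧
      κ + (m - b * ((i + 1 : Fin (n + 1)) : ℕ)) = m - b - b * (i : ℕ) := by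
    rw [Fin.val_add_one]
    by_cases hi : i = Fin.last n
    · refine ⟨_, by rw [if_pos hi, hy], ?_⟩
      rw [if_pos hi, hi, Fin.val_last]
      push_cast
      ring
    · refine ⟨0, by rw [if_neg hi, w.map_one]; rfl, ?_⟩
      rw [if_neg hi]
      push_cast
      ring
  obtain ⟨κ, hκ1, hκ2⟩ := hκ
  constructor
  · intro hi
    have h2 : w ((if i = Fin.last n then y else 1) * u (i + 1)) =
        ((m - b - b * (i : ℕ) : ℤ) : WithTop ℤ) := by
      rw [w.map_mul, hκ1, (h (i + 1)).1 hi, ← WithTop.coe_add, hκ2]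
    rw [w.map_add_eq_of_lt_right (by rwa [h2]), h2]
  · intro hi
    refine w.map_lt_add h1 ?_
    have h2 := (h (i + 1)).2 hi
    rw [w.map_mul, hκ1, ← hκ2, WithTop.coe_add]
    generalize w _ = z at h2 ⊢
    cases z with
    | top =>
      rw [add_top, ← WithTop.coe_add]
      exact WithTop.coe_lt_top _
    | coe z =>
      rw [← WithTop.coe_add, ← WithTop.coe_add]
      rw [WithTop.coe_lt_coe] at h2 ⊢
      omega

theorem IsProfile.list_prod (hw : ∀ c : ℂ, c ≠ 0 → w (algebraMap ℂ 𝕂 c) = 0) {b : ℤ} (hb : 0 < b)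
    {y : 𝕂} (hy : w y = ((-((n + 1 : ℕ) * b) : ℤ) : WithTop ℤ)) {u : Fin (n + 1) → 𝕂} {m : ℤ}
    {J : Set (Fin (n + 1))} (h : IsProfile w b u m J) (a : ℕ → ℤ → ℂ) (l : List ℕ) :
    IsProfile w b ((l.map fun i => cyclicBidiagonal (n + 1) (a i) y).prod.mulVec u)
      (m - l.length * b) {i | i + l.length • (1 : Fin (n + 1)) ∈ J} := by
  induction l with
  | nil => simpa using h
  | cons i l ih =>
    rw [List.map_cons, List.prod_cons, ← Matrix.mulVec_mulVec]
    convert ih.mulVec hw hb hy (a i) using 1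
    · rw [List.length_cons]; push_cast; ring
    · ext j
      simp only [Set.mem_ofPred_eq, List.length_cons]
      rw [succ_nsmul', add_assoc]

theorem IsProfile.xMatrix (hw : ∀ c : ℂ, c ≠ 0 → w (algebraMap ℂ 𝕂 c) = 0) {b : ℤ} (hb : 0 < b)
    {y : 𝕂} (hy : w y = ((-((n + 1 : ℕ) * b) : ℤ) : WithTop ℤ)) {u : Fin (n + 1) → 𝕂} {m : ℤ}
    {J : Set (Fin (n + 1))} (h : IsProfile w b u m J) (M K : ℕ) (I V : ℤ → ℤ → ℂ) (t : ℤ) :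
    IsProfile w b ((RndKP.xMatrix M K (n + 1) I V t y).mulVec u)
      (m - (M + K : ℕ) * b) {i | i + (M + K) • (1 : Fin (n + 1)) ∈ J} := by
  rw [xMatrix_eq, ← Matrix.mulVec_mulVec]
  convert (h.list_prod hw hb hy (fun (j : ℕ) k => I k (t - j * K)) (List.range M)).list_prod hw hb hy
    (fun (j : ℕ) k => V k (t - j * M)) (List.range K).reverse using 1
  · rfl
  · simp only [List.length_reverse, List.length_range]; push_cast; ring
  · ext j
    simp only [Set.mem_ofPred_eq, List.length_reverse, List.length_range]
    rw [add_assoc, ← add_smul, add_comm K M]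

/-- At a pole of `y`, the orders of the components of an eigenvector are equidistributed. -/
theorem profile_of_eigenvector (hw : ∀ c : ℂ, c ≠ 0 → w (algebraMap ℂ 𝕂 c) = 0)
    (hw0 : ∀ f, f ≠ 0 → w f ≠ ⊤) {b : ℤ} (hb : 0 < b)
    {x y : 𝕂} (hy : w y = ((-((n + 1 : ℕ) * b) : ℤ) : WithTop ℤ)) {M K : ℕ}
    (hMK : Nat.Coprime (M + K) (n + 1)) {I V : ℤ → ℤ → ℂ} {t : ℤ}
    {u : Fin (n + 1) → 𝕂} (hu : u ≠ 0)
    (hux : (RndKP.xMatrix M K (n + 1) I V t y).mulVec u = x • u) :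
    w x = ((-((M + K : ℕ) * b) : ℤ) : WithTop ℤ) ∧ ∃ m, IsProfile w b u m Set.univ := by
  obtain ⟨m, J, hJ, h⟩ := exists_isProfile hw0 b hu
  have h1 := h.xMatrix hw hb hy M K I V t
  have hJ' : {i | i + (M + K) • (1 : Fin (n + 1)) ∈ J}.Nonempty := by
    obtain ⟨i, hi⟩ := hJ
    exact ⟨i - (M + K) • (1 : Fin (n + 1)), by simpa using hi⟩
  rw [hux] at h1
  have hx : w x ≠ ⊤ := by
    obtain ⟨i, hi⟩ := hJ'
    have h2 := (h1 i).1 hi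
    intro hx
    rw [Pi.smul_apply, smul_eq_mul, w.map_mul, hx, top_add] at h2
    exact WithTop.coe_ne_top h2.symm
  obtain ⟨k, hk⟩ := WithTop.ne_top_iff_exists.1 hx
  -- The two profiles of `x • u = X_t u`: comparing levels gives `ord x`, comparing index sets gives
  -- invariance of `J` under the shift by `M + K`.
  obtain ⟨e1, e2⟩ := (h.smul hk.symm).unique h1 hJ hJ'
  refine ⟨?_, m, ?_⟩
  · rw [← hk]; congr 1; linarith
  · rwa [eq_univ_of_add_mem_iff hMK hJ e2] at h

end Infinity
-- Hensel's lemma over formal power series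
section Hensel

/-- Hensel's lemma for (not necessarily monic) polynomials over formal power series. -/
theorem exists_powerSeries_root (G : Polynomial (PowerSeries ℂ)) (z₀ : ℂ)
    (h0 : (G.map PowerSeries.constantCoeff).eval z₀ = 0)
    (h1 : (derivative (G.map PowerSeries.constantCoeff)).eval z₀ ≠ 0) :
    ∃ z : PowerSeries ℂ, PowerSeries.constantCoeff z = z₀ ∧ G.eval z = 0 := by
  have hcc : ∀ (H : Polynomial (PowerSeries ℂ)) (a : PowerSeries ℂ),
      PowerSeries.constantCoeff (H.eval a) =
        (H.map PowerSeries.constantCoeff).eval (PowerSeries.constantCoeff a) := by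
    intro H a
    rw [eval_map, eval₂_hom]
  -- Newton iteration with the derivative frozen at `z₀`: each step gains one power of `X`, which
  -- suffices and avoids inverting power series.
  set c := ((derivative (G.map PowerSeries.constantCoeff)).eval z₀)⁻¹ with hc
  let a : ℕ → PowerSeries ℂ := fun n =>
    Nat.rec (PowerSeries.C z₀) (fun _ b => b + (-(PowerSeries.C c * G.eval b))) n
  have ha_succ : ∀ n, a (n + 1) = a n + (-(PowerSeries.C c * G.eval (a n))) := fun n => rfl
  have key : ∀ n, PowerSeries.constantCoeff (a n) = z₀ ∧ PowerSeries.X ^ (n + 1) ∣ G.eval (a n) := by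
    intro n
    induction n with
    | zero =>
      refine ⟨PowerSeries.constantCoeff_C _, ?_⟩
      rw [zero_add, pow_one, PowerSeries.X_dvd_iff, hcc]
      simpa [a] using h0
    | succ n ih =>
      obtain ⟨ih1, g, hg⟩ := ih
      refine ⟨?_, ?_⟩
      · rw [ha_succ, map_add, ih1, hg]
        simp
      · obtain ⟨k, hk⟩ := G.binomExpansion (a n) (-(PowerSeries.C c * G.eval (a n)))
        have hX : (PowerSeries.X : PowerSeries ℂ) ∣
            1 - PowerSeries.C c * (derivative G).eval (a n) := by
          rw [PowerSeries.X_dvd_iff, map_sub, map_mul, hcc, ih1, PowerSeries.constantCoeff_C,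
            ← derivative_map, hc, inv_mul_cancel₀ h1, map_one, sub_self]
        obtain ⟨r, hr⟩ := hX
        rw [ha_succ, hk, hg]
        refine ⟨g * r + PowerSeries.X ^ n * k * PowerSeries.C c ^ 2 * g ^ 2, ?_⟩
        linear_combination PowerSeries.X ^ (n + 1) * g * hr
  have hdvd : ∀ m n, m ≤ n → PowerSeries.X ^ (m + 1) ∣ a n - a m := by
    intro m n hmn
    induction n, hmn using Nat.le_induction with
    | base => simp
    | succ n hmn ih =>
      rw [ha_succ, add_sub_right_comm]
      refine dvd_add ih (dvd_neg.2 (dvd_mul_of_dvd_right ?_ _))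
      exact (pow_dvd_pow _ (by omega)).trans (key n).2
  -- The limit, read off diagonally: the coefficient of `X ^ n` no longer changes after stage `n`.
  refine ⟨PowerSeries.mk fun n => PowerSeries.coeff n (a n), ?_, ?_⟩
  · rw [← PowerSeries.coeff_zero_eq_constantCoeff_apply, PowerSeries.coeff_mk,
      PowerSeries.coeff_zero_eq_constantCoeff_apply, (key 0).1]
  · set z := PowerSeries.mk fun n => PowerSeries.coeff n (a n)
    have hz : ∀ n, PowerSeries.X ^ (n + 1) ∣ z - a n := by
      intro n
      rw [PowerSeries.X_pow_dvd_iff]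
      intro m hm
      have := (PowerSeries.X_pow_dvd_iff.1 (hdvd m n (by omega))) m (by omega)
      rw [map_sub, sub_eq_zero] at this
      rw [map_sub, PowerSeries.coeff_mk, this, sub_self]
    ext n
    have h2 : PowerSeries.X ^ (n + 1) ∣ G.eval z := by
      have := ((hz n).trans (sub_dvd_eval_sub z (a n) G)).add (key n).2
      rwa [sub_add_cancel] at this
    rw [(PowerSeries.X_pow_dvd_iff.1 h2) n (by omega), map_zero]

end Hensel

/-! ### Polynomials in `x` and `y` at a common pole -/

section DistinctOrders

variable {𝕂 : Type*} [CommRing 𝕂] (w : AddValuation 𝕂 (WithTop ℤ))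

theorem map_sum_eq_of_forall_lt {ι : Type*} (s : Finset ι) (f : ι → 𝕂) {j : ι}
    (hj : j ∈ s) (hf : w (f j) ≠ ⊤) (h : ∀ i ∈ s, i ≠ j → w (f j) < w (f i)) :
    w (∑ i ∈ s, f i) = w (f j) := by
  classical
  rw [← Finset.add_sum_erase s f hj]
  refine w.map_add_eq_of_lt_left (w.map_lt_sum' hf.lt_top fun i hi => ?_)
  exact h i (Finset.mem_of_mem_erase hi) (Finset.ne_of_mem_erase hi)

variable [Algebra ℂ 𝕂]

theorem map_aeval_of_neg (hw : ∀ c : ℂ, c ≠ 0 → w (algebraMap ℂ 𝕂 c) = 0) {y : 𝕂} {β : ℤ}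
    (hβ : 0 < β) (hy : w y = ((-β : ℤ) : WithTop ℤ)) {q : ℂ[X]} (hq : q ≠ 0) :
    w (aeval y q) = ((-(β * q.natDegree) : ℤ) : WithTop ℤ) := by
  have hterm : ∀ i ∈ q.support, w (algebraMap ℂ 𝕂 (q.coeff i) * y ^ i) =
      ((-(β * i) : ℤ) : WithTop ℤ) := by
    intro i hi
    rw [w.map_mul, hw _ (mem_support_iff.1 hi), zero_add, w.map_pow, hy, ← WithTop.coe_nsmul]
    congr 1
    rw [nsmul_eq_mul]; ring
  have hmem := natDegree_mem_support_of_nonzero hq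
  rw [aeval_def, eval₂_eq_sum, Polynomial.sum_def, map_sum_eq_of_forall_lt w _ _ hmem]
  · exact hterm _ hmem
  · rw [hterm _ hmem]; exact WithTop.coe_ne_top
  · intro i hi hij
    rw [hterm _ hmem, hterm _ hi, WithTop.coe_lt_coe]
    have h1 : (i : ℤ) < q.natDegree := by
      exact_mod_cast lt_of_le_of_ne (le_natDegree_of_mem_supp i hi) hij
    have : β * i < β * q.natDegree := by gcongr
    omega

/-- The weighted degree of a polynomial in `x` and `y`, where `y` has weight `r` and `x` has
weight `s`. -/
noncomputable def weightedDegree (r s : ℕ) (p : ℂ[X][X]) : ℕ :=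
  p.support.sup fun i => r * (p.coeff i).natDegree + s * i

/-- No two terms have the same order: equal weights give `s * i ≡ s * j` modulo `r`, hence `i = j`,
since `s` is prime to `r` and both exponents are below `r`. The dominant term then determines the
order. -/
theorem map_eval₂_of_neg (hw : ∀ c : ℂ, c ≠ 0 → w (algebraMap ℂ 𝕂 c) = 0) {x y : 𝕂} {r s : ℕ}
    (hr : 0 < r) (hrs : Nat.Coprime s r) {e : ℤ}
    (he : 0 < e) (hy : w y = ((-(r * e) : ℤ) : WithTop ℤ))
    (hx : w x = ((-(s * e) : ℤ) : WithTop ℤ)) {p : ℂ[X][X]} (hp : p ≠ 0) (hpr : p.natDegree < r) :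
    w (p.eval₂ (aeval y : ℂ[X] →ₐ[ℂ] 𝕂).toRingHom x) =
      ((-(e * weightedDegree r s p) : ℤ) : WithTop ℤ) := by
  have hterm : ∀ i ∈ p.support, w ((aeval y : ℂ[X] →ₐ[ℂ] 𝕂).toRingHom (p.coeff i) * x ^ i) =
      ((-(e * (r * (p.coeff i).natDegree + s * i : ℕ)) : ℤ) : WithTop ℤ) := by
    intro i hi
    have h1 : w (aeval y (p.coeff i)) = _ :=
      map_aeval_of_neg w hw (β := r * e) (by positivity) hy (mem_support_iff.1 hi)
    change w (aeval y (p.coeff i) * x ^ i) = _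
    rw [w.map_mul, h1, w.map_pow, hx, ← WithTop.coe_nsmul, ← WithTop.coe_add]
    congr 1
    rw [nsmul_eq_mul]
    push_cast
    ring
  obtain ⟨j, hj, hjmax⟩ := Finset.exists_mem_eq_sup p.support (support_nonempty.2 hp)
    fun i => r * (p.coeff i).natDegree + s * i
  have hne : ∀ i ∈ p.support, i ≠ j →
      r * (p.coeff i).natDegree + s * i < r * (p.coeff j).natDegree + s * j := by
    intro i hi hij
    refine lt_of_le_of_ne ?_ ?_
    · rw [← hjmax]
      exact Finset.le_sup (f := fun i => r * (p.coeff i).natDegree + s * i) hi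
    · intro heq
      have hi' : i < r := (le_natDegree_of_mem_supp i hi).trans_lt hpr
      have hj' : j < r := (le_natDegree_of_mem_supp j hj).trans_lt hpr
      apply hij
      have h1 : s * i ≡ s * j [MOD r] := by
        have := congr_arg (· % r) heq
        simpa [Nat.ModEq, Nat.add_mod] using this
      have h2 := Nat.ModEq.cancel_left_of_coprime (by rwa [Nat.coprime_comm] at hrs) h1
      exact Nat.ModEq.eq_of_lt_of_lt h2 hi' hj'
  rw [eval₂_eq_sum, Polynomial.sum_def, map_sum_eq_of_forall_lt w p.support _ hj]
  · rw [hterm j hj, weightedDegree, hjmax]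
  · rw [hterm j hj]; exact WithTop.coe_ne_top
  · intro i hi hij
    rw [hterm j hj, hterm i hi, WithTop.coe_lt_coe]
    have := hne i hi hij
    have : e * ((r * (p.coeff i).natDegree + s * i : ℕ) : ℤ) <
      e * ((r * (p.coeff j).natDegree + s * j : ℕ) : ℤ) := by gcongr
    omega

end DistinctOrders

/-! ### Spectrum of powers of the cyclic shift -/

section ShiftPower

/-- The `N`-th root of unity `ζ ^ k` is an eigenvalue of the `k`-th power of the cyclic
permutation matrix. -/
theorem shiftMatrix_one_pow_mulVec {n : ℕ} {ζ : ℂ} (hζ : ζ ^ (n + 1) = 1) (k : ℕ) :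
    (shiftMatrix (n + 1) (1 : ℂ) ^ k).mulVec (fun i : Fin (n + 1) => ζ ^ (i : ℕ)) =
      ζ ^ k • fun i : Fin (n + 1) => ζ ^ (i : ℕ) := by
  have h1 : (shiftMatrix (n + 1) (1 : ℂ)).mulVec (fun i : Fin (n + 1) => ζ ^ (i : ℕ)) =
      ζ • fun i : Fin (n + 1) => ζ ^ (i : ℕ) := by
    ext i
    rw [shiftMatrix, cyclicBidiagonal_mulVec_apply, Fin.val_add_one]
    by_cases hi : i = Fin.last n
    · simp [hi, ← pow_succ', hζ]
    · simp [hi, pow_succ']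
  induction k with
  | zero => simp
  | succ k ih =>
    rw [pow_succ, ← Matrix.mulVec_mulVec, h1, Matrix.mulVec_smul, ih, smul_smul, pow_succ']

theorem charpoly_shiftMatrix_one_pow {n k : ℕ} (hk : Nat.Coprime k (n + 1)) :
    (shiftMatrix (n + 1) (1 : ℂ) ^ k).charpoly = X ^ (n + 1) - 1 := by
  set B := shiftMatrix (n + 1) (1 : ℂ) ^ k with hB
  have hmon : (X ^ (n + 1) - 1 : ℂ[X]).Monic := by
    simpa using monic_X_pow_sub_C (1 : ℂ) (Nat.succ_ne_zero n)
  have hdeg : (X ^ (n + 1) - 1 : ℂ[X]).natDegree = n + 1 := by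
    simpa using natDegree_X_pow_sub_C (n := n + 1) (r := (1 : ℂ))
  have hsep : (X ^ (n + 1) - 1 : ℂ[X]).Separable :=
    by
    simpa using separable_X_pow_sub_C (n := n + 1) (1 : ℂ) (by exact_mod_cast Nat.succ_ne_zero n)
      one_ne_zero
  have hdvd : (X ^ (n + 1) - 1 : ℂ[X]) ∣ B.charpoly := by
    refine (IsAlgClosed.splits _).dvd_of_roots_le_roots hmon.ne_zero
      ((Multiset.le_iff_subset (nodup_roots hsep)).2 fun ω hω => ?_)
    have hω1 : ω ^ (n + 1) = 1 := by
      have := (mem_roots'.1 hω).2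
      simpa [IsRoot, sub_eq_zero] using this
    have hω0 : ω ≠ 0 := by
      rintro rfl
      simp at hω1
    have hbez := Nat.gcd_eq_gcd_ab k (n + 1)
    rw [hk.gcd_eq_one] at hbez
    -- By Bézout every root of unity `ω` is a `k`-th power `ζ ^ k`, so all roots of the separable `X
    -- ^ (n + 1) - 1` are eigenvalues and the degrees match.
    set ζ := ω ^ (k.gcdA (n + 1)) with hζ
    have hζk : ζ ^ k = ω := by
      have h1 : ω ^ ((k : ℤ) * k.gcdA (n + 1) + ((n + 1 : ℕ) : ℤ) * k.gcdB (n + 1)) = ω := by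
        rw [← hbez]; simp
      rw [zpow_add₀ hω0, zpow_mul ω ((n + 1 : ℕ) : ℤ), zpow_natCast, hω1, one_zpow, mul_one,
        mul_comm, zpow_mul, zpow_natCast] at h1
      exact h1
    have hζ1 : ζ ^ (n + 1) = 1 := by
      rw [hζ, ← zpow_natCast, ← zpow_mul, mul_comm, zpow_mul, zpow_natCast, hω1, one_zpow]
    have hv := shiftMatrix_one_pow_mulVec hζ1 k
    rw [← hB, hζk] at hv
    rw [mem_roots (Matrix.charpoly_monic _).ne_zero, IsRoot, Matrix.eval_charpoly]
    refine Matrix.exists_mulVec_eq_zero_iff.1 ⟨_, ?_, (?_ : Matrix.mulVec _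
      (fun i : Fin (n + 1) => ζ ^ (i : ℕ)) = 0)⟩
    · intro h
      have := congr_fun h 0
      simp at this
    · rw [Matrix.sub_mulVec, hv, Matrix.scalar_apply, ← Matrix.smul_one_eq_diagonal,
        Matrix.smul_mulVec, Matrix.one_mulVec, sub_self]
  apply eq_of_monic_of_dvd_of_natDegree_le hmon (Matrix.charpoly_monic _) hdvd
  rw [hdeg, Matrix.charpoly_natDegree_eq_dim, Fintype.card_fin]

end ShiftPower
-- Rescaling `X_t` near infinity
section Scaling

variable {R : Type*} [CommRing R] [Algebra ℂ R]

/-- The matrix obtained from `cyclicBidiagonal` by conjugation with a diagonal matrix and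
rescaling. -/
def scaledBidiagonal (N : ℕ) (a : ℤ → ℂ) (s : R) : Matrix (Fin N) (Fin N) R :=
  s • Matrix.diagonal (fun i : Fin N => algebraMap ℂ R (a ((i : ℕ) + 1))) + shiftMatrix N 1

theorem scaledBidiagonal_map {R' : Type*} [CommRing R'] [Algebra ℂ R'] (f : R →ₐ[ℂ] R')
    (N : ℕ) (a : ℤ → ℂ) (s : R) :
    f.mapMatrix (scaledBidiagonal N a s) = scaledBidiagonal N a (f s) := by
  have h := cyclicBidiagonal_map f N (fun _ => 0) 1
  rw [map_one] at h
  rw [scaledBidiagonal, map_add, shiftMatrix, h, scaledBidiagonal, shiftMatrix]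
  congr 1
  ext i j
  by_cases hij : i = j
  · subst hij; simp
  · simp [hij]

/-- Conjugation by `diag(s^i)` turns `S(y)` into `s⁻¹ S(1)`, the corner included because `s ^ (n +
1) * y = 1`; the identity is multiplied out to avoid inverses. -/
theorem smul_diagonal_mul_cyclicBidiagonal {n : ℕ} {s y : R} (hsy : s ^ (n + 1) * y = 1)
    (a : ℤ → ℂ) :
    s • (Matrix.diagonal (fun i : Fin (n + 1) => s ^ (i : ℕ)) * cyclicBidiagonal (n + 1) a y) =
      scaledBidiagonal (n + 1) a s * Matrix.diagonal (fun i : Fin (n + 1) => s ^ (i : ℕ)) := by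
  ext i j
  rw [Matrix.smul_apply, Matrix.diagonal_mul, Matrix.mul_diagonal, scaledBidiagonal,
    Matrix.add_apply, Matrix.smul_apply, Matrix.diagonal_apply, cyclicBidiagonal_apply,
    shiftMatrix, cyclicBidiagonal_apply, smul_eq_mul, smul_eq_mul]
  by_cases h1 : i = j
  · subst h1
    by_cases h2 : (i : ℕ) = 0 ∧ n = 0
    · obtain ⟨h2, rfl⟩ := h2
      rw [pow_one] at hsy
      simp
      linear_combination hsy
    · have h3 : ¬((i : ℕ) + 1 = n + 1 ∧ (i : ℕ) = 0) := by omega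
      rw [if_pos rfl, if_neg (by omega), if_neg h3, if_pos rfl, if_neg h3, if_pos rfl]
      simp
      ring
  · have h1' : (i : ℕ) ≠ j := fun h => h1 (Fin.ext h)
    rw [if_neg h1', if_neg h1, if_neg h1']
    by_cases h2 : (i : ℕ) + 1 = j
    · rw [if_pos h2, if_neg (by omega), if_neg (by omega), ← h2]
      ring
    · by_cases h3 : (i : ℕ) + 1 = n + 1 ∧ (j : ℕ) = 0
      · have h4 : (i : ℕ) = n := by omega
        rw [if_neg h2, if_pos h3, if_pos h3, h3.2, h4]
        linear_combination hsy
      · rw [if_neg h2, if_neg h3, if_neg h3]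
        ring

theorem smul_diagonal_mul_list_prod {n : ℕ} {s y : R} (hsy : s ^ (n + 1) * y = 1)
    (a : ℕ → ℤ → ℂ) (l : List ℕ) :
    s ^ l.length • (Matrix.diagonal (fun i : Fin (n + 1) => s ^ (i : ℕ)) *
        (l.map fun i => cyclicBidiagonal (n + 1) (a i) y).prod) =
      (l.map fun i => scaledBidiagonal (n + 1) (a i) s).prod *
        Matrix.diagonal (fun i : Fin (n + 1) => s ^ (i : ℕ)) := by
  induction l with
  | nil => simp
  | cons i l ih =>
    rw [List.map_cons, List.prod_cons, List.map_cons, List.prod_cons, List.length_cons, pow_succ,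
      mul_smul, ← mul_assoc, ← smul_mul_assoc, smul_diagonal_mul_cyclicBidiagonal hsy, mul_assoc,
      ← mul_smul_comm, ih, mul_assoc]

/-- The rescaled form of the matrix `X_t` near infinity. -/
def scaledXMatrix (M K N : ℕ) (I V : ℤ → ℤ → ℂ) (t : ℤ) (s : R) : Matrix (Fin N) (Fin N) R :=
  ((List.range K).reverse.map fun i : ℕ => scaledBidiagonal N (fun k => V k (t - i * M)) s).prod *
  ((List.range M).map fun j : ℕ => scaledBidiagonal N (fun k => I k (t - j * K)) s).prod

theorem smul_diagonal_mul_xMatrix {n : ℕ} {s y : R} (hsy : s ^ (n + 1) * y = 1)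
    (M K : ℕ) (I V : ℤ → ℤ → ℂ) (t : ℤ) :
    s ^ (M + K) • (Matrix.diagonal (fun i : Fin (n + 1) => s ^ (i : ℕ)) *
        xMatrix M K (n + 1) I V t y) =
      scaledXMatrix M K (n + 1) I V t s *
        Matrix.diagonal (fun i : Fin (n + 1) => s ^ (i : ℕ)) := by
  have h1 := smul_diagonal_mul_list_prod hsy (fun (j : ℕ) k => I k (t - j * K)) (List.range M)
  have h2 := smul_diagonal_mul_list_prod hsy (fun (i : ℕ) k => V k (t - i * M))
    (List.range K).reverse
  rw [List.length_range] at h1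
  rw [List.length_reverse, List.length_range] at h2
  rw [scaledXMatrix, mul_assoc, ← h1, xMatrix_eq, pow_add, mul_smul, mul_smul_comm, ← mul_assoc,
    ← mul_assoc, ← h2, smul_mul_assoc]
  rfl

theorem eval_charpoly_of_scaled [IsDomain R] {n : ℕ} {s σ z : R} (hs : s * σ = 1)
    {M K : ℕ} {I V : ℤ → ℤ → ℂ} {t : ℤ}
    (hz : (scaledXMatrix M K (n + 1) I V t s).charpoly.eval z = 0) :
    (xMatrix M K (n + 1) I V t (σ ^ (n + 1))).charpoly.eval (σ ^ (M + K) * z) = 0 := by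
  have hs0 : s ≠ 0 := left_ne_zero_of_mul_eq_one hs
  have hsy : s ^ (n + 1) * σ ^ (n + 1) = 1 := by rw [← mul_pow, hs, one_pow]
  have h1 := smul_diagonal_mul_xMatrix hsy M K I V t
  rw [Matrix.eval_charpoly] at hz ⊢
  set D := Matrix.diagonal (fun i : Fin (n + 1) => s ^ (i : ℕ)) with hD
  have h2 : s ^ (M + K) • (D * (Matrix.scalar (Fin (n + 1)) (σ ^ (M + K) * z) -
      xMatrix M K (n + 1) I V t (σ ^ (n + 1)))) =
      (Matrix.scalar (Fin (n + 1)) z - scaledXMatrix M K (n + 1) I V t s) * D := by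
    rw [mul_sub, smul_sub, h1, sub_mul]
    congr 1
    rw [(Matrix.scalar_commute (n := Fin (n + 1)) (σ ^ (M + K) * z) (fun r => mul_comm _ r) D).symm.eq,
      ← smul_mul_assoc]
    congr 1
    rw [Matrix.scalar_apply, Matrix.scalar_apply, ← Matrix.smul_one_eq_diagonal,
      ← Matrix.smul_one_eq_diagonal, smul_smul, ← mul_assoc, ← mul_pow, hs, one_pow, one_mul]
  have h3 := congr_arg Matrix.det h2
  rw [Matrix.det_smul, Matrix.det_mul, Matrix.det_mul, hz, zero_mul, hD, Matrix.det_diagonal] at h3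
  refine (mul_eq_zero.1 ((mul_eq_zero.1 h3).resolve_left ?_)).resolve_left ?_
  · exact pow_ne_zero _ (pow_ne_zero _ hs0)
  · exact Finset.prod_ne_zero_iff.2 fun i _ => pow_ne_zero _ hs0

theorem scaledXMatrix_map {R' : Type*} [CommRing R'] [Algebra ℂ R'] (f : R →ₐ[ℂ] R')
    (M K N : ℕ) (I V : ℤ → ℤ → ℂ) (t : ℤ) (s : R) :
    f.mapMatrix (scaledXMatrix M K N I V t s) = scaledXMatrix M K N I V t (f s) := by
  simp only [scaledXMatrix, map_mul, map_list_prod, List.map_map, Function.comp_def,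
    scaledBidiagonal_map]

theorem scaledXMatrix_zero (M K N : ℕ) (I V : ℤ → ℤ → ℂ) (t : ℤ) :
    scaledXMatrix M K N I V t (0 : R) = shiftMatrix N 1 ^ (M + K) := by
  simp [scaledXMatrix, scaledBidiagonal, pow_add, pow_mul_comm]

end Scaling

/-! ### Laurent series and the expansion at infinity -/

section Laurent

/-- The inclusion of the formal power series into the Laurent series, over `ℂ`. -/
noncomputable def powerSeriesToLaurent : PowerSeries ℂ →ₐ[ℂ] LaurentSeries ℂ :=
  { HahnSeries.ofPowerSeries ℤ ℂ with commutes' := fun _ => rfl }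

/-- The constant coefficient as a homomorphism of `ℂ`-algebras. -/
noncomputable def constantCoeffAlgHom : PowerSeries ℂ →ₐ[ℂ] ℂ :=
  { (PowerSeries.constantCoeff : PowerSeries ℂ →+* ℂ) with
    commutes' := fun _ => PowerSeries.constantCoeff_C _ }

theorem algebraMap_laurentSeries (c : ℂ) : algebraMap ℂ (LaurentSeries ℂ) c = HahnSeries.C c :=
  HahnSeries.ofPowerSeries_C c

theorem addVal_algebraMap (c : ℂ) (hc : c ≠ 0) :
    HahnSeries.addVal ℤ ℂ (algebraMap ℂ (LaurentSeries ℂ) c) = 0 := by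
  rw [algebraMap_laurentSeries, HahnSeries.addVal_apply, HahnSeries.C_apply,
    HahnSeries.orderTop_single hc]
  rfl

theorem addVal_ne_top (f : LaurentSeries ℂ) (hf : f ≠ 0) : HahnSeries.addVal ℤ ℂ f ≠ ⊤ := by
  rw [HahnSeries.addVal_apply_of_ne hf]
  exact WithTop.coe_ne_top

theorem addVal_residue (f : LaurentSeries ℂ) (hf : 0 ≤ HahnSeries.addVal ℤ ℂ f) :
    ∃ c : ℂ, 0 < HahnSeries.addVal ℤ ℂ (f - algebraMap ℂ (LaurentSeries ℂ) c) := by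
  refine ⟨f.coeff 0, ?_⟩
  rw [algebraMap_laurentSeries]
  have h1 : (0 : WithTop ℤ) ≤ HahnSeries.addVal ℤ ℂ (f - HahnSeries.C (f.coeff 0)) := by
    refine AddValuation.map_le_sub _ hf ?_
    rw [← algebraMap_laurentSeries]
    exact map_const_nonneg _ addVal_algebraMap _
  refine lt_of_le_of_ne h1 fun h => ?_
  have h2 : (f - HahnSeries.C (f.coeff 0)).coeff 0 = 0 := by simp
  by_cases h0 : f - HahnSeries.C (f.coeff 0) = 0
  · rw [h0, AddValuation.map_zero] at h
    exact WithTop.zero_ne_top h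
  · rw [HahnSeries.addVal_apply_of_ne h0] at h
    have h3 : (f - HahnSeries.C (f.coeff 0)).order = 0 := by exact_mod_cast h.symm
    have h4 := HahnSeries.coeff_order_eq_zero.not.2 h0
    rw [h3] at h4
    exact h4 h2

/-- At `s = 0` the rescaled characteristic polynomial is `X ^ (n + 1) - 1`, whose root `1` is
simple; Hensel lifts it to `z`, and `x = s^(-(M + K)) z` solves the original equation at `y = s^(-(n
+ 1))`. -/
theorem exists_laurentSeries_root {n M K : ℕ} (hcop : Nat.Coprime (M + K) (n + 1))
    (I V : ℤ → ℤ → ℂ) (t : ℤ) :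
    ∃ ξ : LaurentSeries ℂ, (xMatrix M K (n + 1) I V t
      (HahnSeries.single (-1) 1 ^ (n + 1) : LaurentSeries ℂ)).charpoly.eval ξ = 0 := by
  set B := scaledXMatrix M K (n + 1) I V t (PowerSeries.X : PowerSeries ℂ) with hB
  have hmap : B.charpoly.map PowerSeries.constantCoeff = X ^ (n + 1) - 1 := by
    rw [← Matrix.charpoly_map, ← charpoly_shiftMatrix_one_pow hcop,
      ← scaledXMatrix_zero M K (n + 1) I V t]
    have h := scaledXMatrix_map constantCoeffAlgHom M K (n + 1) I V t PowerSeries.X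
    rw [show constantCoeffAlgHom PowerSeries.X = 0 from PowerSeries.constantCoeff_X] at h
    rw [← h]
    rfl
  obtain ⟨z, -, hz⟩ := exists_powerSeries_root B.charpoly 1 (by rw [hmap]; simp)
    (by rw [hmap]; simp; exact_mod_cast Nat.succ_ne_zero n)
  refine ⟨_, eval_charpoly_of_scaled (s := HahnSeries.single 1 1)
    (z := powerSeriesToLaurent z) ?_ ?_⟩
  · simp
  · have h := scaledXMatrix_map powerSeriesToLaurent M K (n + 1) I V t PowerSeries.X
    rw [show powerSeriesToLaurent PowerSeries.X = HahnSeries.single 1 1 from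
      HahnSeries.ofPowerSeries_X] at h
    rw [← h, AlgHom.mapMatrix_apply]
    change ((B.map powerSeriesToLaurent.toRingHom).charpoly).eval (powerSeriesToLaurent.toRingHom z) = 0
    rw [Matrix.charpoly_map, eval_map, eval₂_hom, hz, map_zero]

end Laurent

/-! ### The coordinate ring and its embedding into Laurent series -/

section CoordinateRing

variable {M K N : ℕ} {I V : ℤ → ℤ → ℂ} {t : ℤ}

theorem spectralPoly_monic : (spectralPoly M K N I V t).Monic := Matrix.charpoly_monic _

theorem spectralPoly_natDegree : (spectralPoly M K N I V t).natDegree = N := by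
  rw [spectralPoly, Matrix.charpoly_natDegree_eq_dim, Fintype.card_fin]

theorem eval₂_spectralPoly {R : Type*} [CommRing R] [Algebra ℂ R] (x y : R) :
    (spectralPoly M K N I V t).eval₂ (aeval y : ℂ[X] →ₐ[ℂ] R) x =
      (xMatrix M K N I V t y).charpoly.eval x := by
  have h := xMatrix_map (aeval y : ℂ[X] →ₐ[ℂ] R) M K N I V t X
  rw [aeval_X] at h
  rw [← h, AlgHom.mapMatrix_apply]
  change _ = (((xMatrix M K N I V t X).map (aeval y : ℂ[X] →ₐ[ℂ] R).toRingHom).charpoly).eval x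
  rw [Matrix.charpoly_map, eval_map]
  rfl

theorem algHom_mk {R : Type*} [CommRing R] [Algebra ℂ R]
    (φ : CoordinateRing M K N I V t →ₐ[ℂ] R) (p : ℂ[X][X]) :
    φ (AdjoinRoot.mk _ p) =
      p.eval₂ (aeval (φ (AdjoinRoot.of _ X)) : ℂ[X] →ₐ[ℂ] R).toRingHom
        (φ (AdjoinRoot.root _)) := by
  have h : φ.toRingHom.comp (AdjoinRoot.mk (spectralPoly M K N I V t)) =
      eval₂RingHom (aeval (φ (AdjoinRoot.of _ X)) : ℂ[X] →ₐ[ℂ] R).toRingHom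
        (φ (AdjoinRoot.root _)) := by
    apply ringHom_ext'
    · apply ringHom_ext
      · intro c
        simp only [RingHom.comp_apply, coe_eval₂RingHom, eval₂_C]
        trans algebraMap ℂ R c
        · exact φ.commutes c
        · exact ((aeval (φ (AdjoinRoot.of _ X)) : ℂ[X] →ₐ[ℂ] R).commutes c).symm
      · simp
    · simp
  exact congr_arg (fun f => f p) h

/-- The homomorphism from the coordinate ring given by a point of the curve in a `ℂ`-algebra. -/
noncomputable def coordHom {R : Type*} [CommRing R] [Algebra ℂ R] (x y : R)
    (h : (xMatrix M K N I V t y).charpoly.eval x = 0) : CoordinateRing M K N I V t →ₐ[ℂ] R :=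
  AdjoinRoot.liftAlgHom _ (aeval y : ℂ[X] →ₐ[ℂ] R) x (by rw [eval₂_spectralPoly, h])

theorem coordHom_root {R : Type*} [CommRing R] [Algebra ℂ R] (x y : R)
    (h : (xMatrix M K N I V t y).charpoly.eval x = 0) :
    coordHom x y h (AdjoinRoot.root _) = x :=
  AdjoinRoot.liftAlgHom_root _ _ _ _

theorem coordHom_of {R : Type*} [CommRing R] [Algebra ℂ R] (x y : R)
    (h : (xMatrix M K N I V t y).charpoly.eval x = 0) (q : ℂ[X]) :
    coordHom x y h (AdjoinRoot.of _ q) = aeval y q :=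
  AdjoinRoot.liftAlgHom_of _ _ _ _ _

/-- The weighted degree of the normal form of an element of the coordinate ring. -/
noncomputable def infDegree (f : CoordinateRing M K N I V t) : ℕ :=
  weightedDegree N (M + K) (AdjoinRoot.modByMonicHom spectralPoly_monic f)

/-- The normal form of `f` modulo the monic `F` has degree below `N` in `x`, so `map_eval₂_of_neg`
applies. The order depends on `φ` only through `e`, which yields both injectivity of the expansion
and uniqueness of the place. -/
theorem map_algHom_of_neg {R : Type*} [CommRing R] [Algebra ℂ R] {w : AddValuation R (WithTop ℤ)}
    (hw : ∀ c : ℂ, c ≠ 0 → w (algebraMap ℂ R c) = 0) (hN : 0 < N)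
    (hcop : Nat.Coprime (M + K) N) (φ : CoordinateRing M K N I V t →ₐ[ℂ] R) {e : ℤ} (he : 0 < e)
    (hy : w (φ (AdjoinRoot.of _ X)) = ((-(N * e) : ℤ) : WithTop ℤ))
    (hx : w (φ (AdjoinRoot.root _)) = ((-((M + K : ℕ) * e) : ℤ) : WithTop ℤ))
    {f : CoordinateRing M K N I V t} (hf : f ≠ 0) :
    w (φ f) = ((-(e * infDegree f) : ℤ) : WithTop ℤ) := by
  have h1 := AdjoinRoot.mk_leftInverse (spectralPoly_monic (M := M) (K := K) (N := N) (I := I) (V := V) (t := t)) f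
  set p := AdjoinRoot.modByMonicHom spectralPoly_monic f with hp
  have hp0 : p ≠ 0 := by
    intro h
    rw [h, map_zero] at h1
    exact hf h1.symm
  have hdeg : p.natDegree < N := by
    obtain ⟨q, rfl⟩ := AdjoinRoot.mk_surjective f
    rw [AdjoinRoot.modByMonicHom_mk] at hp
    conv_rhs => rw [← spectralPoly_natDegree (M := M) (K := K) (N := N) (I := I) (V := V) (t := t)]
    rw [hp]
    refine natDegree_modByMonic_lt _ spectralPoly_monic ?_
    intro h
    have := spectralPoly_natDegree (M := M) (K := K) (N := N) (I := I) (V := V) (t := t)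
    rw [h, natDegree_one] at this
    omega
  conv_lhs => rw [← h1, algHom_mk]
  exact map_eval₂_of_neg w hw hN hcop he hy hx hp0 hdeg

theorem exists_eigenvector {R : Type*} [CommRing R] [IsDomain R] [Algebra ℂ R] {x y : R}
    (h : (xMatrix M K N I V t y).charpoly.eval x = 0) :
    ∃ u : Fin N → R, u ≠ 0 ∧ (xMatrix M K N I V t y).mulVec u = x • u := by
  rw [Matrix.eval_charpoly] at h
  obtain ⟨u, hu, h0⟩ := Matrix.exists_mulVec_eq_zero_iff.2 h
  refine ⟨u, hu, ?_⟩
  rw [Matrix.sub_mulVec, sub_eq_zero, Matrix.scalar_apply, ← Matrix.smul_one_eq_diagonal,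
        Matrix.smul_mulVec, Matrix.one_mulVec] at h0
  exact h0.symm

/-- The Puiseux expansion at infinity. -/
theorem exists_laurent_embedding (hN : 0 < N) (hcop : Nat.Coprime (M + K) N) :
    ∃ φ : CoordinateRing M K N I V t →ₐ[ℂ] LaurentSeries ℂ, Function.Injective φ ∧
      HahnSeries.addVal ℤ ℂ (φ (AdjoinRoot.of _ X)) = ((-N : ℤ) : WithTop ℤ) ∧
      HahnSeries.addVal ℤ ℂ (φ (AdjoinRoot.root _)) = ((-(M + K : ℕ) : ℤ) : WithTop ℤ) := by
  obtain ⟨n, rfl⟩ : ∃ n, N = n + 1 := ⟨N - 1, by omega⟩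
  obtain ⟨ξ, hξ⟩ := exists_laurentSeries_root hcop I V t
  obtain ⟨u, hu, hux⟩ := exists_eigenvector hξ
  have hy : HahnSeries.addVal ℤ ℂ (HahnSeries.single (-1) 1 ^ (n + 1) : LaurentSeries ℂ) =
      ((-((n + 1 : ℕ) * 1) : ℤ) : WithTop ℤ) := by
    rw [AddValuation.map_pow, HahnSeries.addVal_apply, HahnSeries.orderTop_single one_ne_zero,
      ← WithTop.coe_nsmul]
    congr 1
  have hx := (profile_of_eigenvector addVal_algebraMap addVal_ne_top one_pos hy hcop hu hux).1
  refine ⟨coordHom _ _ hξ, ?_, ?_, ?_⟩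
  · rw [injective_iff_map_eq_zero]
    intro f hf
    by_contra hf0
    have h := map_algHom_of_neg addVal_algebraMap hN hcop (coordHom _ _ hξ) one_pos
      (by rw [coordHom_of, aeval_X, hy]) (by rw [coordHom_root, hx]) hf0
    rw [hf, AddValuation.map_zero] at h
    exact WithTop.coe_ne_top h.symm
  · rw [coordHom_of, aeval_X, hy, mul_one]
  · rw [coordHom_root, hx, mul_one]

theorem isDomain_coordinateRing (hN : 0 < N) (hcop : Nat.Coprime (M + K) N) :
    IsDomain (CoordinateRing M K N I V t) := by
  obtain ⟨φ, hφ, -⟩ := exists_laurent_embedding (I := I) (V := V) (t := t) hN hcop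
  exact hφ.isDomain φ.toRingHom

end CoordinateRing
-- Surjectivity of valuations and algebraic elements over `ℂ`
section Fields

variable {𝕂 : Type*} [Field 𝕂] (w : AddValuation 𝕂 (WithTop ℤ))

theorem map_zpow_of_eq {f : 𝕂} {r : ℤ} (hf : w f = r) (k : ℤ) :
    w (f ^ k) = ((k * r : ℤ) : WithTop ℤ) := by
  have hf0 : f ≠ 0 := by
    rintro rfl
    rw [w.map_zero] at hf
    exact WithTop.coe_ne_top hf.symm
  have hpow : ∀ m : ℕ, w (f ^ m) = ((m * r : ℤ) : WithTop ℤ) := by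
    intro m
    rw [w.map_pow, hf, ← WithTop.coe_nsmul, nsmul_eq_mul]
  obtain ⟨m, rfl | rfl⟩ := k.eq_nat_or_neg
  · rw [zpow_natCast, hpow]
  · have h1 : w (f ^ (-(m : ℤ))) + w (f ^ m) = 0 := by
      rw [← w.map_mul, zpow_neg, zpow_natCast, inv_mul_cancel₀ (pow_ne_zero _ hf0), w.map_one]
    rw [hpow] at h1
    generalize w _ = z at h1 ⊢
    cases z with
    | top => exact absurd h1 (by simp)
    | coe z =>
      rw [← WithTop.coe_add] at h1
      have : z + m * r = 0 := by exact_mod_cast h1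
      congr 1
      linarith

theorem surjective_of_eq_one {f : 𝕂} (hf : w f = (1 : ℤ)) : Function.Surjective w := by
  intro z
  cases z with
  | top => exact ⟨0, w.map_zero⟩
  | coe z => exact ⟨f ^ z, by rw [map_zpow_of_eq w hf, mul_one]⟩

theorem surjective_of_coprime {f g : 𝕂} {a b : ℕ} (hab : Nat.Coprime a b)
    (hf : w f = ((-a : ℤ) : WithTop ℤ)) (hg : w g = ((-b : ℤ) : WithTop ℤ)) :
    Function.Surjective w := by
  have hbez := Nat.gcd_eq_gcd_ab a b
  rw [hab.gcd_eq_one] at hbez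
  refine surjective_of_eq_one w (f := f ^ (-a.gcdA b) * g ^ (-a.gcdB b)) ?_
  rw [w.map_mul, map_zpow_of_eq w hf, map_zpow_of_eq w hg, ← WithTop.coe_add]
  congr 1
  push_cast at hbez
  linarith

end Fields

section Transcendence

variable {R : Type*} [CommRing R] [IsDomain R] [Algebra ℂ R]

theorem mem_range_of_aeval_eq_zero {z : R} {q : ℂ[X]} (hq : q ≠ 0) (h : aeval z q = 0) :
    z ∈ Set.range (algebraMap ℂ R) := by
  have h1 := (IsAlgClosed.splits q).eq_prod_roots
  rw [h1, map_mul, map_multiset_prod, mul_eq_zero, Multiset.map_map, Multiset.prod_eq_zero_iff] at h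
  rcases h with h | h
  · rw [aeval_C, map_eq_zero_iff _ (FaithfulSMul.algebraMap_injective ℂ R)] at h
    exact absurd h (leadingCoeff_ne_zero.2 hq)
  · obtain ⟨r, -, hr⟩ := Multiset.mem_map.1 h
    refine ⟨r, ?_⟩
    simp only [Function.comp_apply, map_sub, aeval_X, aeval_C] at hr
    exact (sub_eq_zero.1 hr).symm

end Transcendence

/-! ### Places of the function field and the point at infinity -/

section Places

variable {M K N : ℕ} {I V : ℤ → ℤ → ℂ} {t : ℤ}

/-- The inclusion of the coordinate ring into the function field. -/
noncomputable def toFunctionField (M K N : ℕ) (I V : ℤ → ℤ → ℂ) (t : ℤ) :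
    CoordinateRing M K N I V t →ₐ[ℂ] FunctionField M K N I V t :=
  IsScalarTower.toAlgHom ℂ _ _

theorem toFunctionField_root : toFunctionField M K N I V t (AdjoinRoot.root _) = xFun M K N I V t :=
  rfl

theorem toFunctionField_of : toFunctionField M K N I V t (AdjoinRoot.of _ X) = yFun M K N I V t :=
  rfl

theorem eval_charpoly_map {R R' : Type*} [CommRing R] [Algebra ℂ R] [CommRing R'] [Algebra ℂ R']
    (φ : R →ₐ[ℂ] R') (x y : R) :
    φ ((xMatrix M K N I V t y).charpoly.eval x) = (xMatrix M K N I V t (φ y)).charpoly.eval (φ x) := by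
  rw [← xMatrix_map φ, AlgHom.mapMatrix_apply]
  change φ.toRingHom _ = (((xMatrix M K N I V t y).map φ.toRingHom).charpoly).eval (φ.toRingHom x)
  rw [Matrix.charpoly_map, eval_map, eval₂_hom]

theorem eval_charpoly_coord {R : Type*} [CommRing R] [Algebra ℂ R]
    (φ : CoordinateRing M K N I V t →ₐ[ℂ] R) :
    (xMatrix M K N I V t (φ (AdjoinRoot.of _ X))).charpoly.eval (φ (AdjoinRoot.root _)) = 0 := by
  have h := algHom_mk φ (spectralPoly M K N I V t)
  rw [AdjoinRoot.mk_self, map_zero] at h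
  rw [← eval₂_spectralPoly]
  exact h.symm

theorem eval_charpoly_xFun :
    (xMatrix M K N I V t (yFun M K N I V t)).charpoly.eval (xFun M K N I V t) = 0 :=
  eval_charpoly_coord (toFunctionField M K N I V t)

namespace SpectralCurve

theorem ext_ord {p q : SpectralCurve M K N I V t} (h : ∀ f, p.ord f = q.ord f) : p = q := by
  cases p; cases q
  congr
  exact AddValuation.ext h

variable [IsDomain (CoordinateRing M K N I V t)]

theorem ord_ne_top (p : SpectralCurve M K N I V t) (f : FunctionField M K N I V t) (hf : f ≠ 0) :
    p.ord f ≠ ⊤ :=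
  (AddValuation.ne_top_iff p.ord).2 hf

/-- Two places whose orders on the coordinate ring are proportional coincide. -/
theorem eq_of_proportional {p q : SpectralCurve M K N I V t} {d e : ℤ} (hd : 0 < d) (he : 0 < e)
    (h : ∀ f : CoordinateRing M K N I V t, f ≠ 0 → ∃ k : ℤ,
      p.ord (toFunctionField M K N I V t f) = ((d * k : ℤ) : WithTop ℤ) ∧
      q.ord (toFunctionField M K N I V t f) = ((e * k : ℤ) : WithTop ℤ)) : p = q := by
  have key : ∀ z : FunctionField M K N I V t, z ≠ 0 → ∃ k : ℤ,
      p.ord z = ((d * k : ℤ) : WithTop ℤ) ∧ q.ord z = ((e * k : ℤ) : WithTop ℤ) := by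
    intro z hz
    obtain ⟨a, b, hb, rfl⟩ := IsFractionRing.div_surjective (CoordinateRing M K N I V t) z
    have hb0 : b ≠ 0 := nonZeroDivisors.ne_zero hb
    have hb1 : algebraMap _ (FunctionField M K N I V t) b ≠ 0 :=
      IsFractionRing.to_map_ne_zero_of_mem_nonZeroDivisors hb
    have ha0 : a ≠ 0 := by
      rintro rfl
      simp at hz
    obtain ⟨k, hk1, hk2⟩ := h a ha0
    obtain ⟨l, hl1, hl2⟩ := h b hb0
    set z := algebraMap _ (FunctionField M K N I V t) a / algebraMap _ (FunctionField M K N I V t) b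
    have hmul : z * toFunctionField M K N I V t b = toFunctionField M K N I V t a :=
      div_mul_cancel₀ _ hb1
    have aux : ∀ (r : SpectralCurve M K N I V t) (c : ℤ),
        r.ord (toFunctionField M K N I V t a) = ((c * k : ℤ) : WithTop ℤ) →
        r.ord (toFunctionField M K N I V t b) = ((c * l : ℤ) : WithTop ℤ) →
        r.ord z = ((c * (k - l) : ℤ) : WithTop ℤ) := by
      intro r c h1 h2
      have h3 := congr_arg r.ord hmul
      rw [r.ord.map_mul, h1, h2] at h3
      generalize r.ord z = o at h3 ⊢
      cases o with
      | top => exact absurd (h3.symm.trans (top_add _)) WithTop.coe_ne_top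
      | coe o =>
        rw [← WithTop.coe_add, WithTop.coe_inj] at h3
        congr 1
        linarith
    exact ⟨k - l, aux p d hk1 hl1, aux q e hk2 hl2⟩
  -- Normalisation removes the factor: an element of order one forces `c = 1`.
  have hone : ∀ (r : SpectralCurve M K N I V t) (c : ℤ), 0 < c →
      (∀ z : FunctionField M K N I V t, z ≠ 0 → ∃ k : ℤ, r.ord z = ((c * k : ℤ) : WithTop ℤ)) →
      c = 1 := by
    intro r c hc hr
    obtain ⟨z, hz⟩ := r.surjective ((1 : ℤ) : WithTop ℤ)
    have hz0 : z ≠ 0 := by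
      rintro rfl
      rw [r.ord.map_zero] at hz
      exact WithTop.coe_ne_top hz.symm
    obtain ⟨k, hk⟩ := hr z hz0
    rw [hz, WithTop.coe_inj] at hk
    exact Int.eq_one_of_mul_eq_one_right hc.le hk.symm
  obtain rfl := hone p d hd fun z hz => (key z hz).imp fun k hk => hk.1
  obtain rfl := hone q e he fun z hz => (key z hz).imp fun k hk => hk.2
  apply ext_ord
  intro z
  by_cases hz : z = 0
  · rw [hz, p.ord.map_zero, q.ord.map_zero]
  · obtain ⟨k, h1, h2⟩ := key z hz
    rw [h1, h2]

/-- The place belonging to a Laurent expansion. -/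
theorem exists_of_laurent (φ : CoordinateRing M K N I V t →ₐ[ℂ] LaurentSeries ℂ)
    (hφ : Function.Injective φ)
    (hsurj : ∀ w : AddValuation (FunctionField M K N I V t) (WithTop ℤ),
      (∀ f, w (toFunctionField M K N I V t f) = HahnSeries.addVal ℤ ℂ (φ f)) →
      Function.Surjective w) :
    ∃ p : SpectralCurve M K N I V t,
      (∀ f, p.ord (toFunctionField M K N I V t f) = HahnSeries.addVal ℤ ℂ (φ f)) ∧
      ∀ f, 0 ≤ p.ord f → ∃ c : ℂ, 0 < p.ord (f - algebraMap ℂ _ c) := by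
  let ψ : FunctionField M K N I V t →ₐ[ℂ] LaurentSeries ℂ :=
    IsFractionRing.liftAlgHom (A := CoordinateRing M K N I V t) (g := φ) hφ
  have hψ : ∀ f, ψ (toFunctionField M K N I V t f) = φ f := fun f =>
    IsFractionRing.lift_algebraMap (A := CoordinateRing M K N I V t) (g := φ.toRingHom) hφ f
  let w : AddValuation (FunctionField M K N I V t) (WithTop ℤ) :=
    (HahnSeries.addVal ℤ ℂ).comap ψ.toRingHom
  have hw : ∀ f, w f = HahnSeries.addVal ℤ ℂ (ψ f) := fun f => rfl
  refine ⟨⟨w, hsurj w fun f => by rw [hw, hψ], fun c hc => ?_⟩, fun f => ?_, fun f hf => ?_⟩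
  · rw [hw, ψ.commutes, addVal_algebraMap c hc]
  · rw [hw, hψ]
  · obtain ⟨c, hc⟩ := addVal_residue (ψ f) hf
    refine ⟨c, ?_⟩
    rw [hw, map_sub, ψ.commutes]
    exact hc

/-- The orders of the coordinates at a pole of `y`. -/
theorem ord_of_ord_y_neg (hN : 0 < N) (hcop : Nat.Coprime (M + K) N)
    (p : SpectralCurve M K N I V t) (hp : p.ord (yFun M K N I V t) < 0) :
    ∃ e : ℤ, 0 < e ∧ p.ord (yFun M K N I V t) = ((-(N * e) : ℤ) : WithTop ℤ) ∧
      p.ord (xFun M K N I V t) = ((-((M + K : ℕ) * e) : ℤ) : WithTop ℤ) := by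
  obtain ⟨n, rfl⟩ : ∃ n, N = n + 1 := ⟨N - 1, by omega⟩
  obtain ⟨b, hb⟩ := WithTop.ne_top_iff_exists.1 (ne_top_of_lt hp)
  rw [← hb] at hp
  have hb0 : b < 0 := by exact_mod_cast hp
  obtain ⟨u, hu, hux⟩ := exists_eigenvector (eval_charpoly_xFun (M := M) (K := K) (N := n + 1)
    (I := I) (V := V) (t := t))
  -- `N` is not yet known to divide `ord y`, so the profile argument is run for the valuation `N ·
  -- ord`; divisibility follows afterwards from coprimality.
  let w : AddValuation (FunctionField M K (n + 1) I V t) (WithTop ℤ) :=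
    p.ord.map (nsmulAddMonoidHom (n + 1)) (by simp [succ_nsmul]) (fun a b h => nsmul_le_nsmul_right h _)
  have hw : ∀ f, w f = (n + 1) • p.ord f := fun f => rfl
  have hy : w (yFun M K (n + 1) I V t) = ((-((n + 1 : ℕ) * -b) : ℤ) : WithTop ℤ) := by
    rw [hw, ← hb, ← WithTop.coe_nsmul]
    congr 1
    rw [nsmul_eq_mul]; ring
  have hw0 : ∀ f, f ≠ 0 → w f ≠ ⊤ := fun f hf => by
    obtain ⟨k, hk⟩ := WithTop.ne_top_iff_exists.1 (p.ord_ne_top f hf)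
    rw [hw, ← hk, ← WithTop.coe_nsmul]
    exact WithTop.coe_ne_top
  have hx := (profile_of_eigenvector (fun c hc => by rw [hw, p.ord_const c hc, nsmul_zero]) hw0
    (by omega) hy hcop hu hux).1
  rw [hw] at hx
  have hx' : p.ord (xFun M K (n + 1) I V t) ≠ ⊤ := by
    intro h
    rw [h, succ_nsmul, add_top] at hx
    exact WithTop.coe_ne_top hx.symm
  obtain ⟨k, hk⟩ := WithTop.ne_top_iff_exists.1 hx'
  rw [← hk, ← WithTop.coe_nsmul, WithTop.coe_inj, nsmul_eq_mul] at hx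
  have hdvd : ((n + 1 : ℕ) : ℤ) ∣ -b := by
    have h1 : ((n + 1 : ℕ) : ℤ) ∣ ((M + K : ℕ) : ℤ) * -b := ⟨-k, by linarith⟩
    exact (Nat.isCoprime_iff_coprime.2 hcop.symm).dvd_of_dvd_mul_left h1
  obtain ⟨e, he⟩ := hdvd
  have hn : (0 : ℤ) < (n + 1 : ℕ) := by positivity
  refine ⟨e, ?_, ?_, ?_⟩
  · by_contra hcon
    nlinarith
  · rw [← hb, ← he]; simp
  · rw [← hk]
    congr 1
    rw [he] at hx
    have : ((n + 1 : ℕ) : ℤ) * (k + (M + K : ℕ) * e) = 0 := by linear_combination hx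
    have := (mul_eq_zero.1 this).resolve_left hn.ne'
    linarith

theorem atInfinity_iff (hN : 0 < N) (hM : 0 < M) (hcop : Nat.Coprime (M + K) N)
    (p : SpectralCurve M K N I V t) : p.AtInfinity ↔ p.ord (yFun M K N I V t) < 0 := by
  refine ⟨fun h => h.2, fun h => ⟨?_, h⟩⟩
  obtain ⟨e, he, -, h2⟩ := p.ord_of_ord_y_neg hN hcop h
  rw [h2]
  have : -(((M + K : ℕ) : ℤ) * e) < 0 := by
    have : (0 : ℤ) < (M + K : ℕ) := by positivity
    have := mul_pos this he
    omega
  exact_mod_cast this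

/-- At every pole of `y` the order of `f` is a fixed negative multiple of `infDegree f`, so any such
place is proportional to the one given by the Laurent expansion. -/
theorem exists_atInfinity (hN : 0 < N) (hM : 0 < M) (hcop : Nat.Coprime (M + K) N) :
    ∃ P : SpectralCurve M K N I V t, (∀ p : SpectralCurve M K N I V t, p.AtInfinity ↔ p = P) ∧
      P.ord (yFun M K N I V t) = ((-N : ℤ) : WithTop ℤ) := by
  obtain ⟨φ, hφ, hy, hx⟩ := exists_laurent_embedding (I := I) (V := V) (t := t) hN hcop
  obtain ⟨P, hP, -⟩ := exists_of_laurent φ hφ fun w hw =>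
    surjective_of_coprime w hcop ((hw _).trans hx) ((hw _).trans hy)
  have hPy : P.ord (yFun M K N I V t) = ((-N : ℤ) : WithTop ℤ) := (hP _).trans hy
  have hPx : P.ord (xFun M K N I V t) = ((-(M + K : ℕ) : ℤ) : WithTop ℤ) := (hP _).trans hx
  have hPinf : P.AtInfinity := by
    rw [atInfinity_iff hN hM hcop, hPy]
    have : -(N : ℤ) < 0 := by omega
    exact_mod_cast this
  refine ⟨P, fun p => ⟨fun hp => ?_, fun hp => hp ▸ hPinf⟩, hPy⟩
  obtain ⟨e, he, hy', hx'⟩ := p.ord_of_ord_y_neg hN hcop hp.2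
  refine eq_of_proportional he one_pos fun f hf => ⟨-infDegree f, ?_, ?_⟩
  · rw [map_algHom_of_neg p.ord_const hN hcop _ he hy' hx' hf]
    congr 1; ring
  · rw [map_algHom_of_neg P.ord_const hN hcop (toFunctionField M K N I V t) one_pos
      (by rw [toFunctionField_of, hPy, mul_one]) (by rw [toFunctionField_root, hPx, mul_one]) hf]
    congr 1; ring

/-- Multiplication by a bidiagonal matrix lowers the order of an eigenvector at infinity by one. -/
theorem vecOrd_mulVec_infinity (hN : 0 < N) (hcop : Nat.Coprime (M + K) N)
    (P : SpectralCurve M K N I V t) (hP : P.ord (yFun M K N I V t) = ((-N : ℤ) : WithTop ℤ))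
    (a : ℤ → ℂ) {v : Fin N → FunctionField M K N I V t} (hv : IsEigenvector M K N I V t v) :
    P.vecOrd ((cyclicBidiagonal N a (yFun M K N I V t)).mulVec v) = P.vecOrd v + (-1 : ℤ) := by
  obtain ⟨n, rfl⟩ : ∃ n, N = n + 1 := ⟨N - 1, by omega⟩
  have hy : P.ord (yFun M K (n + 1) I V t) = ((-((n + 1 : ℕ) * 1) : ℤ) : WithTop ℤ) := by
    rw [hP, mul_one]
  obtain ⟨-, m, hm⟩ := profile_of_eigenvector P.ord_const P.ord_ne_top one_pos hy hcop hv.1 hv.2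
  have h1 := hm.mulVec P.ord_const one_pos hy a
  have h2 : {i : Fin (n + 1) | i + 1 ∈ (Set.univ : Set (Fin (n + 1)))} = Set.univ := by simp
  rw [h2] at h1
  change vecMin P.ord _ = vecMin P.ord _ + _
  rw [hm.vecMin_eq, h1.vecMin_eq, ← WithTop.coe_add]
  congr 1
  ring

end SpectralCurve

end Places
-- First order expansion at an affine point
section TaylorExpansion

/-- First order expansion of a polynomial in two variables. -/
theorem exists_taylor (p : ℂ[X][X]) (x₀ y₀ : ℂ) :
    ∃ (a : ℂ[X][X]) (b : ℂ[X]),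
      p = (X - C (C x₀)) * a + C (X - C y₀) * C b + C (C (p.evalEval y₀ x₀)) ∧
      a.evalEval y₀ x₀ = (derivative (p.map (evalRingHom y₀))).eval x₀ ∧
      b.eval y₀ = (derivative (p.eval (C x₀))).eval y₀ := by
  obtain ⟨a, ha⟩ := X_sub_C_dvd_sub_C_eval (p := p) (a := C x₀)
  obtain ⟨b, hb⟩ := X_sub_C_dvd_sub_C_eval (p := p.eval (C x₀)) (a := y₀)
  refine ⟨a, b, ?_, ?_, ?_⟩
  · rw [← ha, ← C_mul, ← hb, evalEval]
    simp
  · have h1 := congr_arg (fun q => (derivative (q.map (evalRingHom y₀))).eval x₀) ha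
    simpa [derivative_mul, evalEval, eval_map, eval₂_evalRingHom] using h1.symm
  · have h1 := congr_arg (fun q => (derivative q).eval y₀) hb
    simpa [derivative_mul] using h1.symm

end TaylorExpansion

/-! ### Uniqueness of the place at a smooth affine point -/

section AffinePoints

variable {M K N : ℕ} {I V : ℤ → ℤ → ℂ} {t : ℤ}

theorem evalEval_spectralPoly (x₀ y₀ : ℂ) : (spectralPoly M K N I V t).evalEval y₀ x₀ =
    (xMatrix M K N I V t y₀).charpoly.eval x₀ := by
  rw [← eval₂_spectralPoly, ← eval₂_evalRingHom]
  congr 1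

theorem algebraMap_coordinateRing (c : ℂ) : algebraMap ℂ (CoordinateRing M K N I V t) c =
    AdjoinRoot.of (spectralPoly M K N I V t) (C c) :=
  rfl

theorem exists_eq_add_of_evaluation {x₀ y₀ : ℂ}
    (h : (xMatrix M K N I V t y₀).charpoly.eval x₀ = 0) (f : CoordinateRing M K N I V t) :
    ∃ a b : CoordinateRing M K N I V t,
      f = (AdjoinRoot.root _ - algebraMap ℂ _ x₀) * a +
        (AdjoinRoot.of _ X - algebraMap ℂ _ y₀) * b + algebraMap ℂ _ (coordHom x₀ y₀ h f) := by
  obtain ⟨p, rfl⟩ := AdjoinRoot.mk_surjective f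
  obtain ⟨a, b, hp, -, -⟩ := exists_taylor p x₀ y₀
  refine ⟨AdjoinRoot.mk _ a, AdjoinRoot.of _ b, ?_⟩
  have h1 : coordHom x₀ y₀ h (AdjoinRoot.mk _ p) = p.evalEval y₀ x₀ := by
    rw [algHom_mk, coordHom_of, coordHom_root, aeval_X, ← eval₂_evalRingHom]
    congr 1
  rw [h1]
  have h2 := congr_arg (AdjoinRoot.mk (spectralPoly M K N I V t)) hp
  simp only [algebraMap_coordinateRing]
  simpa using h2

/-- At a smooth point, the ideal of the point is locally principal. -/
theorem exists_local_parameter (hC : IsSmooth M K N I V t) {x₀ y₀ : ℂ}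
    (h : (xMatrix M K N I V t y₀).charpoly.eval x₀ = 0) :
    ∃ π γ : CoordinateRing M K N I V t, coordHom x₀ y₀ h π = 0 ∧ coordHom x₀ y₀ h γ ≠ 0 ∧
      ∀ f, coordHom x₀ y₀ h f = 0 → ∃ f', γ * f = π * f' := by
  have hev : (spectralPoly M K N I V t).evalEval y₀ x₀ = 0 := by rw [evalEval_spectralPoly, h]
  obtain ⟨a, b, hp, ha, hb⟩ := exists_taylor (spectralPoly M K N I V t) x₀ y₀
  have hrel := congr_arg (AdjoinRoot.mk (spectralPoly M K N I V t)) hp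
  rw [AdjoinRoot.mk_self, hev] at hrel
  have hrel' : (AdjoinRoot.root _ - algebraMap ℂ (CoordinateRing M K N I V t) x₀) *
      AdjoinRoot.mk _ a + (AdjoinRoot.of _ X - algebraMap ℂ _ y₀) * AdjoinRoot.of _ b = 0 := by
    simp only [algebraMap_coordinateRing]
    simpa using hrel.symm
  have h1 : coordHom x₀ y₀ h (AdjoinRoot.mk _ a) = a.evalEval y₀ x₀ := by
    rw [algHom_mk, coordHom_of, coordHom_root, aeval_X, ← eval₂_evalRingHom]
    congr 1
  have h2 : coordHom x₀ y₀ h (AdjoinRoot.of _ b) = b.eval y₀ := by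
    rw [coordHom_of, coe_aeval_eq_eval]
  have hx : coordHom x₀ y₀ h (AdjoinRoot.root _ - algebraMap ℂ _ x₀) = 0 := by
    rw [map_sub, coordHom_root, AlgHom.commutes]; simp
  have hy : coordHom x₀ y₀ h (AdjoinRoot.of _ X - algebraMap ℂ _ y₀) = 0 := by
    rw [map_sub, coordHom_of, aeval_X, AlgHom.commutes]; simp
  -- In the ring, `(x - x₀) a + (y - y₀) b = 0`, where `a` and `b` take the values of the two
  -- partial derivatives. If `a` is nonzero at the point, `a (x - x₀)` is a multiple of `y - y₀`, so
  -- `π = y - y₀` and `γ = a`; the other case is symmetric.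
  rcases hC x₀ y₀ hev with hs | hs
  · rw [← ha, ← h1] at hs
    refine ⟨_, _, hy, hs, fun f hf => ?_⟩
    obtain ⟨a', b', hf'⟩ := exists_eq_add_of_evaluation h f
    rw [hf, map_zero, add_zero] at hf'
    refine ⟨AdjoinRoot.mk _ a * b' - AdjoinRoot.of _ b * a', ?_⟩
    rw [hf']
    linear_combination a' * hrel'
  · rw [← hb, ← h2] at hs
    refine ⟨_, _, hx, hs, fun f hf => ?_⟩
    obtain ⟨a', b', hf'⟩ := exists_eq_add_of_evaluation h f
    rw [hf, map_zero, add_zero] at hf'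
    refine ⟨AdjoinRoot.of _ b * a' - AdjoinRoot.mk _ a * b', ?_⟩
    rw [hf']
    linear_combination b' * hrel'

namespace SpectralCurve

theorem HasCoords.ord_sub_pos {p : SpectralCurve M K N I V t} {x₀ y₀ : ℂ} (hp : p.HasCoords x₀ y₀)
    (h : (xMatrix M K N I V t y₀).charpoly.eval x₀ = 0) (f : CoordinateRing M K N I V t) :
    0 ≤ p.ord (toFunctionField M K N I V t f) ∧
    0 < p.ord (toFunctionField M K N I V t f - algebraMap ℂ _ (coordHom x₀ y₀ h f)) := by
  have hx := nonneg_of_sub_pos p.ord p.ord_const hp.1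
  have hy := nonneg_of_sub_pos p.ord p.ord_const hp.2
  have hnn : ∀ g : CoordinateRing M K N I V t, 0 ≤ p.ord (toFunctionField M K N I V t g) := by
    intro g
    obtain ⟨q, rfl⟩ := AdjoinRoot.mk_surjective g
    rw [algHom_mk, eval₂_eq_sum_range]
    refine p.ord.map_le_sum fun i _ => ?_
    rw [p.ord.map_mul, p.ord.map_pow]
    exact add_nonneg (map_aeval_nonneg p.ord p.ord_const hy _) (nsmul_nonneg hx _)
  refine ⟨hnn f, ?_⟩
  obtain ⟨a, b, hab⟩ := exists_eq_add_of_evaluation h f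
  have h1 : toFunctionField M K N I V t f - algebraMap ℂ _ (coordHom x₀ y₀ h f) =
      (xFun M K N I V t - algebraMap ℂ _ x₀) * toFunctionField M K N I V t a +
      (yFun M K N I V t - algebraMap ℂ _ y₀) * toFunctionField M K N I V t b := by
    have h2 := congr_arg (toFunctionField M K N I V t) hab
    rw [map_add, map_add, map_mul, map_mul, map_sub, map_sub, AlgHom.commutes, AlgHom.commutes,
      AlgHom.commutes, toFunctionField_root, toFunctionField_of] at h2
    rw [sub_eq_iff_eq_add]
    exact h2
  rw [h1]
  refine p.ord.map_lt_add ?_ ?_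
  · rw [p.ord.map_mul]
    exact add_pos_of_pos_of_nonneg hp.1 (hnn a)
  · rw [p.ord.map_mul]
    exact add_pos_of_pos_of_nonneg hp.2 (hnn b)

theorem HasCoords.ord_eq_zero {p : SpectralCurve M K N I V t} {x₀ y₀ : ℂ}
    (hp : p.HasCoords x₀ y₀)
    (h : (xMatrix M K N I V t y₀).charpoly.eval x₀ = 0) {f : CoordinateRing M K N I V t}
    (hf : coordHom x₀ y₀ h f ≠ 0) : p.ord (toFunctionField M K N I V t f) = 0 := by
  have h1 := (hp.ord_sub_pos h f).2
  have h2 := p.ord_const _ hf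
  rw [← h2] at h1 ⊢
  exact p.ord.map_eq_of_lt_sub h1

theorem HasCoords.ord_pos {p : SpectralCurve M K N I V t} {x₀ y₀ : ℂ}
    (hp : p.HasCoords x₀ y₀)
    (h : (xMatrix M K N I V t y₀).charpoly.eval x₀ = 0) {f : CoordinateRing M K N I V t}
    (hf : coordHom x₀ y₀ h f = 0) : 0 < p.ord (toFunctionField M K N I V t f) := by
  have h1 := (hp.ord_sub_pos h f).2
  rwa [hf, map_zero, sub_zero] at h1

variable [IsDomain (CoordinateRing M K N I V t)]

theorem toFunctionField_ne_zero {f : CoordinateRing M K N I V t} (hf : f ≠ 0) :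
    toFunctionField M K N I V t f ≠ 0 :=
  IsFractionRing.to_map_ne_zero_of_mem_nonZeroDivisors (mem_nonZeroDivisors_of_ne_zero hf)

/-- A smooth affine point carries at most one place. -/
theorem HasCoords.eq (hC : IsSmooth M K N I V t) {p q : SpectralCurve M K N I V t} {x₀ y₀ : ℂ}
    (h : (xMatrix M K N I V t y₀).charpoly.eval x₀ = 0)
    (hp : p.HasCoords x₀ y₀) (hq : q.HasCoords x₀ y₀) : p = q := by
  obtain ⟨π, γ, hπ, hγ, hdiv⟩ := exists_local_parameter hC h
  have hπ0 : π ≠ 0 := by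
    -- If `π = 0`, no nonzero function vanishes at the point, so `p` has order zero on all nonzero
    -- functions, against surjectivity.
    rintro rfl
    have hγ0 : γ ≠ 0 := by
      rintro rfl
      exact hγ (map_zero _)
    have hx : coordHom x₀ y₀ h (AdjoinRoot.root _ - algebraMap ℂ _ x₀) = 0 := by
      rw [map_sub, coordHom_root, AlgHom.commutes]; simp
    have hy : coordHom x₀ y₀ h (AdjoinRoot.of _ X - algebraMap ℂ _ y₀) = 0 := by
      rw [map_sub, coordHom_of, aeval_X, AlgHom.commutes]; simp
    have hzero : ∀ f, coordHom x₀ y₀ h f = 0 → f = 0 := by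
      intro f hf
      obtain ⟨f', hf'⟩ := hdiv f hf
      rw [zero_mul] at hf'
      exact (mul_eq_zero.1 hf').resolve_left hγ0
    obtain ⟨z, hz⟩ := p.surjective ((1 : ℤ) : WithTop ℤ)
    have hz0 : z ≠ 0 := by
      rintro rfl
      rw [p.ord.map_zero] at hz
      exact WithTop.coe_ne_top hz.symm
    obtain ⟨a, b, hb, rfl⟩ := IsFractionRing.div_surjective (CoordinateRing M K N I V t) z
    have hb0 : b ≠ 0 := nonZeroDivisors.ne_zero hb
    have ha0 : a ≠ 0 := by
      rintro rfl
      simp at hz0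
    have hao := hp.ord_eq_zero h (mt (hzero a) ha0)
    have hbo := hp.ord_eq_zero h (mt (hzero b) hb0)
    have hmul := congr_arg p.ord (div_mul_cancel₀ (algebraMap _ (FunctionField M K N I V t) a)
      (IsFractionRing.to_map_ne_zero_of_mem_nonZeroDivisors hb))
    rw [p.ord.map_mul, hz] at hmul
    change _ + p.ord (toFunctionField M K N I V t b) = p.ord (toFunctionField M K N I V t a) at hmul
    rw [hao, hbo] at hmul
    exact absurd hmul (by decide)
  -- Factors `π` are removed while `f` vanishes at the point. The order at `p` only bounds the
  -- number of rounds; the resulting identity does not involve `p` and so also computes the order at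
  -- `q`.
  have hstep : ∀ (m : ℕ) (f : CoordinateRing M K N I V t),
      p.ord (toFunctionField M K N I V t f) ≤ ((m : ℤ) : WithTop ℤ) →
      ∃ (k : ℕ) (g f' : CoordinateRing M K N I V t), g * f = π ^ k * f' ∧
        coordHom x₀ y₀ h g ≠ 0 ∧ coordHom x₀ y₀ h f' ≠ 0 := by
    intro m
    induction m with
    | zero =>
      intro f hf
      refine ⟨0, 1, f, by simp, by simp, fun h0 => ?_⟩
      exact absurd (hp.ord_pos h h0) (not_lt.2 (by exact_mod_cast hf))
    | succ m ih =>
      intro f hf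
      by_cases h0 : coordHom x₀ y₀ h f = 0
      · obtain ⟨f₁, hf₁⟩ := hdiv f h0
        have h1 := congr_arg (fun z => p.ord (toFunctionField M K N I V t z)) hf₁
        simp only [map_mul, p.ord.map_mul] at h1
        rw [hp.ord_eq_zero h hγ, zero_add] at h1
        have h2 := hp.ord_pos h hπ
        obtain ⟨k, g, f', hk, hg, hf'⟩ := ih f₁ (by
          rw [h1] at hf
          generalize p.ord (toFunctionField M K N I V t π) = u at hf h2
          generalize p.ord (toFunctionField M K N I V t f₁) = u' at hf ⊢
          cases u with
          | top => exact absurd (top_le_iff.1 hf) WithTop.coe_ne_top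
          | coe u =>
            cases u' with
            | top => exact absurd (top_le_iff.1 hf) WithTop.coe_ne_top
            | coe u' =>
              rw [← WithTop.coe_add, WithTop.coe_le_coe] at hf
              have h3 : 0 < u := by exact_mod_cast h2
              rw [WithTop.coe_le_coe]
              push_cast at hf
              omega)
        refine ⟨k + 1, g * γ, f', ?_, by rw [map_mul]; exact mul_ne_zero hg hγ, hf'⟩
        rw [mul_assoc, hf₁]
        linear_combination π * hk
      · exact ⟨0, 1, f, by simp, by simp, h0⟩
  obtain ⟨d, hd⟩ := WithTop.ne_top_iff_exists.1 (p.ord_ne_top _ (toFunctionField_ne_zero hπ0))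
  obtain ⟨e, he⟩ := WithTop.ne_top_iff_exists.1 (q.ord_ne_top _ (toFunctionField_ne_zero hπ0))
  have hd0 : 0 < d := by
    have := hp.ord_pos h hπ
    rw [← hd] at this
    exact_mod_cast this
  have he0 : 0 < e := by
    have := hq.ord_pos h hπ
    rw [← he] at this
    exact_mod_cast this
  refine eq_of_proportional hd0 he0 fun f hf => ?_
  obtain ⟨m, hm⟩ := WithTop.ne_top_iff_exists.1 (p.ord_ne_top _ (toFunctionField_ne_zero hf))
  obtain ⟨k, g, f', hk, hg, hf'⟩ := hstep m.toNat f (by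
    rw [← hm, WithTop.coe_le_coe]
    exact Int.self_le_toNat m)
  have aux : ∀ (r : SpectralCurve M K N I V t) (c : ℤ), r.HasCoords x₀ y₀ →
      (c : WithTop ℤ) = r.ord (toFunctionField M K N I V t π) →
      r.ord (toFunctionField M K N I V t f) = ((c * k : ℤ) : WithTop ℤ) := by
    intro r c hr hc
    have h1 := congr_arg (fun z => r.ord (toFunctionField M K N I V t z)) hk
    simp only [map_mul, map_pow, r.ord.map_mul, r.ord.map_pow] at h1
    rw [hr.ord_eq_zero h hg, hr.ord_eq_zero h hf', zero_add, add_zero, ← hc, ← WithTop.coe_nsmul]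
      at h1
    rw [h1, nsmul_eq_mul, mul_comm]
  exact ⟨k, aux p d hp hd, aux q e hq he⟩

end SpectralCurve

end AffinePoints
-- Existence of the place at a smooth affine point
section Expansions

variable {M K N : ℕ} {I V : ℤ → ℤ → ℂ} {t : ℤ}

theorem map_spectralPoly (y₀ : ℂ) : (spectralPoly M K N I V t).map (evalRingHom y₀) =
    (xMatrix M K N I V t y₀).charpoly := by
  have h := xMatrix_map (aeval y₀ : ℂ[X] →ₐ[ℂ] ℂ) M K N I V t X
  rw [aeval_X] at h
  rw [spectralPoly, ← Matrix.charpoly_map, ← h]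
  congr 1

theorem C_add_X_notMem_range (c : ℂ) :
    PowerSeries.C c + PowerSeries.X ∉ Set.range (algebraMap ℂ (PowerSeries ℂ)) := by
  rintro ⟨r, hr⟩
  have h := congr_arg (PowerSeries.coeff 1) hr
  rw [show algebraMap ℂ (PowerSeries ℂ) r = PowerSeries.C r from rfl] at h
  simp at h

/-- A homomorphism under which `y` is transcendental is injective. -/
theorem injective_of_notMem_range [IsDomain (CoordinateRing M K N I V t)] {R : Type*} [CommRing R]
    [IsDomain R] [Algebra ℂ R] (φ : CoordinateRing M K N I V t →ₐ[ℂ] R)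
    (hφ : φ (AdjoinRoot.of _ X) ∉ Set.range (algebraMap ℂ R)) : Function.Injective φ := by
  have hfin : Module.Finite ℂ[X] (CoordinateRing M K N I V t) :=
    spectralPoly_monic.finite_adjoinRoot
  change Function.Injective φ.toRingHom
  rw [RingHom.injective_iff_ker_eq_bot]
  -- The coordinate ring is integral over `ℂ[y]`, so a nonzero kernel would contain a nonzero
  -- polynomial in `y`.
  apply Ideal.eq_bot_of_comap_eq_bot (R := ℂ[X])
  rw [eq_bot_iff]
  intro q hq
  rw [Ideal.mem_comap, RingHom.mem_ker] at hq
  by_contra hq0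
  apply hφ
  apply mem_range_of_aeval_eq_zero (q := q) hq0
  have h1 := algHom_mk φ (C q)
  rw [eval₂_C] at h1
  exact h1.symm.trans hq

/-- The Taylor expansion at a smooth affine point. -/
theorem exists_powerSeries_point (hC : IsSmooth M K N I V t) {x₀ y₀ : ℂ}
    (h : (xMatrix M K N I V t y₀).charpoly.eval x₀ = 0) :
    ∃ x y : PowerSeries ℂ, (xMatrix M K N I V t y).charpoly.eval x = 0 ∧
      PowerSeries.constantCoeff x = x₀ ∧ PowerSeries.constantCoeff y = y₀ ∧
      (x = PowerSeries.C x₀ + PowerSeries.X ∨ y = PowerSeries.C y₀ + PowerSeries.X) ∧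
      y ∉ Set.range (algebraMap ℂ (PowerSeries ℂ)) := by
  have hev : (spectralPoly M K N I V t).evalEval y₀ x₀ = 0 := by rw [evalEval_spectralPoly, h]
  -- The coordinate whose partial derivative survives is solved for by Hensel; the other one is the
  -- parameter.
  rcases hC x₀ y₀ hev with hs | hs
  · set y := PowerSeries.C y₀ + PowerSeries.X with hy
    have hy0 : PowerSeries.constantCoeff y = y₀ := by simp [hy]
    have hmap : (xMatrix M K N I V t y).charpoly.map PowerSeries.constantCoeff =
        (xMatrix M K N I V t y₀).charpoly := by
      rw [← Matrix.charpoly_map]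
      have h1 := xMatrix_map constantCoeffAlgHom M K N I V t y
      rw [show constantCoeffAlgHom y = y₀ from hy0] at h1
      rw [← h1]
      rfl
    rw [map_spectralPoly] at hs
    obtain ⟨x, hx0, hx⟩ := exists_powerSeries_root (xMatrix M K N I V t y).charpoly x₀
      (by rw [hmap, h]) (by rwa [hmap])
    exact ⟨x, y, hx, hx0, hy0, Or.inr hy, C_add_X_notMem_range y₀⟩
  · set x := PowerSeries.C x₀ + PowerSeries.X with hx
    have hx0 : PowerSeries.constantCoeff x = x₀ := by simp [hx]
    set G := (xMatrix M K N I V t (X : (PowerSeries ℂ)[X])).charpoly.eval (C x) with hG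
    have hmap : G.map PowerSeries.constantCoeff = (spectralPoly M K N I V t).eval (C x₀) := by
      have h1 := eval_charpoly_map (M := M) (K := K) (N := N) (I := I) (V := V) (t := t)
        (mapAlgHom constantCoeffAlgHom) (C x) X
      have h2 : mapAlgHom constantCoeffAlgHom (C x) = C x₀ := by
        rw [← hx0]; exact map_C _
      have h3 : mapAlgHom constantCoeffAlgHom (X : (PowerSeries ℂ)[X]) = X := map_X _
      rw [h2, h3] at h1
      exact h1
    obtain ⟨y, hy0, hy⟩ := exists_powerSeries_root G y₀ (by rw [hmap]; exact hev) (by rwa [hmap])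
    have hroot : (xMatrix M K N I V t y).charpoly.eval x = 0 := by
      have h1 := eval_charpoly_map (M := M) (K := K) (N := N) (I := I) (V := V) (t := t)
        ((aeval y : (PowerSeries ℂ)[X] →ₐ[PowerSeries ℂ] PowerSeries ℂ).restrictScalars ℂ) (C x) X
      simp only [AlgHom.restrictScalars_apply, aeval_X, aeval_C, ← hG, Algebra.algebraMap_self,
        RingHom.id_apply, coe_aeval_eq_eval] at h1
      rw [← h1, hy]
    refine ⟨x, y, hroot, hx0, hy0, Or.inl hx, ?_⟩
    -- A constant `y = c` would make `x = x₀ + X` a root of the characteristic polynomial of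
    -- `X_t(c)`, hence constant.
    rintro ⟨c, rfl⟩
    have hcc : (xMatrix M K N I V t (algebraMap ℂ (PowerSeries ℂ) c)).charpoly.eval x =
        aeval x (xMatrix M K N I V t c).charpoly := by
      have h1 := xMatrix_map (Algebra.ofId ℂ (PowerSeries ℂ)) M K N I V t c
      rw [Algebra.ofId_apply] at h1
      rw [← h1, aeval_def, ← eval_map, ← Matrix.charpoly_map]
      rfl
    rw [hcc] at hroot
    exact C_add_X_notMem_range x₀
      (mem_range_of_aeval_eq_zero (Matrix.charpoly_monic _).ne_zero hroot)

variable [IsDomain (CoordinateRing M K N I V t)]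

/-- A smooth affine point carries a place, at which one of the coordinates is a local
parameter. -/
theorem SpectralCurve.exists_hasCoords (hC : IsSmooth M K N I V t) {x₀ y₀ : ℂ}
    (h : (xMatrix M K N I V t y₀).charpoly.eval x₀ = 0) :
    ∃ p : SpectralCurve M K N I V t, p.HasCoords x₀ y₀ ∧
      (p.ord (xFun M K N I V t - algebraMap ℂ _ x₀) = (1 : ℤ) ∨
        p.ord (yFun M K N I V t - algebraMap ℂ _ y₀) = (1 : ℤ)) ∧
      ∀ f, 0 ≤ p.ord f → ∃ c : ℂ, 0 < p.ord (f - algebraMap ℂ _ c) := by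
  obtain ⟨x, y, hxy, hx0, hy0, hpar, hy⟩ := exists_powerSeries_point hC h
  let φ₀ := coordHom x y hxy
  have hφ₀ : Function.Injective φ₀ := injective_of_notMem_range φ₀ (by
    rw [coordHom_of, aeval_X]; exact hy)
  have hι : Function.Injective powerSeriesToLaurent := HahnSeries.ofPowerSeries_injective
  let φ := powerSeriesToLaurent.comp φ₀
  have hφ : Function.Injective φ := hι.comp hφ₀
  have hφx : φ (AdjoinRoot.root _ - algebraMap ℂ _ x₀) =
      powerSeriesToLaurent (x - PowerSeries.C x₀) := by
    rw [AlgHom.comp_apply, map_sub, coordHom_root, AlgHom.commutes]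
    rfl
  have hφy : φ (AdjoinRoot.of _ X - algebraMap ℂ _ y₀) =
      powerSeriesToLaurent (y - PowerSeries.C y₀) := by
    rw [AlgHom.comp_apply, map_sub, coordHom_of, aeval_X, AlgHom.commutes]
    rfl
  have hX : HahnSeries.addVal ℤ ℂ (powerSeriesToLaurent PowerSeries.X) = (1 : ℤ) := by
    rw [show powerSeriesToLaurent PowerSeries.X = HahnSeries.single 1 1 from
      HahnSeries.ofPowerSeries_X, HahnSeries.addVal_apply, HahnSeries.orderTop_single one_ne_zero]
  have hnn : ∀ z, 0 ≤ HahnSeries.addVal ℤ ℂ (powerSeriesToLaurent z) := by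
    intro z
    by_cases hz : powerSeriesToLaurent z = 0
    · rw [hz, AddValuation.map_zero]; exact le_top
    rw [HahnSeries.addVal_apply_of_ne hz]
    by_contra hneg
    have hneg' : (powerSeriesToLaurent z).order < 0 := by
      rw [not_le] at hneg
      exact_mod_cast hneg
    refine HahnSeries.coeff_order_eq_zero.not.2 hz ?_
    have h1 := PowerSeries.coeff_coe z (powerSeriesToLaurent z).order
    rw [if_pos hneg'] at h1
    exact h1
  have hpos : ∀ (z : PowerSeries ℂ) (c : ℂ), PowerSeries.constantCoeff z = c →
      0 < HahnSeries.addVal ℤ ℂ (powerSeriesToLaurent (z - PowerSeries.C c)) := by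
    intro z c hz
    obtain ⟨r, hr⟩ := PowerSeries.X_dvd_iff.2 (show PowerSeries.constantCoeff
      (z - PowerSeries.C c) = 0 by rw [map_sub, hz, PowerSeries.constantCoeff_C, sub_self])
    rw [hr, map_mul, AddValuation.map_mul, hX]
    exact add_pos_of_pos_of_nonneg (by decide) (hnn r)
  have hpar' : HahnSeries.addVal ℤ ℂ (φ (AdjoinRoot.root _ - algebraMap ℂ _ x₀)) = (1 : ℤ) ∨
      HahnSeries.addVal ℤ ℂ (φ (AdjoinRoot.of _ X - algebraMap ℂ _ y₀)) = (1 : ℤ) := by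
    rcases hpar with rfl | rfl
    · left; rw [hφx, add_sub_cancel_left, hX]
    · right; rw [hφy, add_sub_cancel_left, hX]
  have hxF : toFunctionField M K N I V t (AdjoinRoot.root _ - algebraMap ℂ _ x₀) =
      xFun M K N I V t - algebraMap ℂ _ x₀ := by
    rw [map_sub, AlgHom.commutes, toFunctionField_root]
  have hyF : toFunctionField M K N I V t (AdjoinRoot.of _ X - algebraMap ℂ _ y₀) =
      yFun M K N I V t - algebraMap ℂ _ y₀ := by
    rw [map_sub, AlgHom.commutes, toFunctionField_of]
  obtain ⟨p, hp, hres⟩ := exists_of_laurent φ hφ fun w hw => by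
    rcases hpar' with h1 | h1
    · exact surjective_of_eq_one w ((hw _).trans h1)
    · exact surjective_of_eq_one w ((hw _).trans h1)
  refine ⟨p, ⟨?_, ?_⟩, ?_, hres⟩
  · rw [← hxF, hp, hφx]; exact hpos x x₀ hx0
  · rw [← hyF, hp, hφy]; exact hpos y y₀ hy0
  · rw [← hxF, ← hyF, hp, hp]; exact hpar'

end Expansions

/-! ### From a bidiagonal right factor to the orders of `T v` -/

section Factors

variable {M K N : ℕ} {I V : ℤ → ℤ → ℂ} {t : ℤ} [IsDomain (CoordinateRing M K N I V t)]

/-- If a bidiagonal matrix is a right factor of `X_t - c`, then it raises the order of the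
eigenvectors by one at the point over `c` where it is singular, and it preserves the order at all
other finite points. -/
theorem exists_point_of_factor (hN : 0 < N) (hC : IsSmooth M K N I V t) {a : ℤ → ℂ} {c : ℂ}
    {Y : Matrix (Fin N) (Fin N) ℂ[X]}
    (hfac : xMatrix M K N I V t (X : ℂ[X]) - Matrix.scalar _ (C c) =
      Y * cyclicBidiagonal N a (X : ℂ[X])) :
    ∃ Q : SpectralCurve M K N I V t,
      (∀ p : SpectralCurve M K N I V t,
        p.HasCoords c ((-1) ^ N * ∏ n ∈ Finset.Icc 1 N, a n) ↔ p = Q) ∧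
      ∀ v, IsEigenvector M K N I V t v →
        Q.vecOrd ((cyclicBidiagonal N a (yFun M K N I V t)).mulVec v) = Q.vecOrd v + (1 : ℤ) ∧
        ∀ p, p ≠ Q → 0 ≤ p.ord (yFun M K N I V t) →
          p.vecOrd ((cyclicBidiagonal N a (yFun M K N I V t)).mulVec v) = p.vecOrd v := by
  set T := cyclicBidiagonal N a (X : ℂ[X]) with hT
  set y₀ := (-1) ^ N * ∏ n ∈ Finset.Icc 1 N, a n with hy₀
  have hsq : ∀ {R : Type} [CommRing R], (-1 : R) ^ N * (-1) ^ N = 1 := fun {R} _ => by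
    rw [← mul_pow]; simp
  have hTmap : ∀ {R : Type} [CommRing R] [Algebra ℂ R] (y : R),
      (aeval y : ℂ[X] →ₐ[ℂ] R).mapMatrix T = cyclicBidiagonal N a y := by
    intro R _ _ y
    rw [hT, cyclicBidiagonal_map, aeval_X]
  have hAmap : ∀ {R : Type} [CommRing R] [Algebra ℂ R] (y : R),
      (aeval y : ℂ[X] →ₐ[ℂ] R).mapMatrix (xMatrix M K N I V t X) = xMatrix M K N I V t y := by
    intro R _ _ y
    rw [xMatrix_map, aeval_X]
  have hdetT : aeval (yFun M K N I V t) T.det =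
      algebraMap ℂ _ (-(-1) ^ N) * (yFun M K N I V t - algebraMap ℂ _ y₀) := by
    rw [AlgHom.map_det, hTmap, det_cyclicBidiagonal hN, hy₀]
    simp only [map_mul, map_neg, map_pow, map_one]
    linear_combination -algebraMap ℂ (FunctionField M K N I V t) (∏ n ∈ Finset.Icc 1 N, a n) *
      hsq (R := FunctionField M K N I V t)
  have hdet0 : (T.map (eval y₀)).det = 0 := by
    have h1 : T.map (eval y₀) = (aeval y₀ : ℂ[X] →ₐ[ℂ] ℂ).mapMatrix T := rfl
    rw [h1, hTmap, det_cyclicBidiagonal hN, hy₀]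
    simp only [Algebra.algebraMap_self, RingHom.id_apply]
    linear_combination -(∏ n ∈ Finset.Icc 1 N, a n) * hsq (R := ℂ)
  have hroot : (xMatrix M K N I V t y₀).charpoly.eval c = 0 := by
    rw [Matrix.eval_charpoly, ← neg_sub, Matrix.det_neg]
    have h1 := congr_arg (fun Z => ((aeval y₀ : ℂ[X] →ₐ[ℂ] ℂ).mapMatrix Z).det) hfac
    simp only [map_mul, map_sub, hAmap, Matrix.det_mul] at h1
    have h2 : (aeval y₀ : ℂ[X] →ₐ[ℂ] ℂ).mapMatrix (Matrix.scalar (Fin N) (C c)) =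
        Matrix.scalar (Fin N) c := by
      rw [Matrix.scalar_apply, AlgHom.mapMatrix_apply, Matrix.diagonal_map (map_zero (aeval y₀ : ℂ[X] →ₐ[ℂ] ℂ))]
      simp
    rw [h2] at h1
    rw [h1, show ((aeval y₀ : ℂ[X] →ₐ[ℂ] ℂ).mapMatrix T).det = 0 from hdet0]
    simp
  obtain ⟨Q, hQ, hpar, hres⟩ := SpectralCurve.exists_hasCoords hC hroot
  have hneg1 : (-(-1) ^ N : ℂ) ≠ 0 := by
    simp
  have hord : ∀ p : SpectralCurve M K N I V t, p.ord (aeval (yFun M K N I V t) T.det) =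
      p.ord (yFun M K N I V t - algebraMap ℂ _ y₀) := by
    intro p
    rw [hdetT, p.ord.map_mul, p.ord_const _ hneg1, zero_add]
  have hQiff : ∀ p : SpectralCurve M K N I V t, p.HasCoords c y₀ ↔ p = Q :=
    fun p => ⟨fun hp => hp.eq hC hroot hQ, fun hp => hp ▸ hQ⟩
  refine ⟨Q, hQiff, fun v hv => ⟨?_, fun p hpQ hpy => ?_⟩⟩
  · have hvA : ((aeval (yFun M K N I V t)).mapMatrix (xMatrix M K N I V t (X : ℂ[X]))).mulVec v =
        xFun M K N I V t • v := by rw [hAmap]; exact hv.2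
    have hQy := nonneg_of_sub_pos Q.ord Q.ord_const hQ.2
    have hle : vecMin Q.ord (((aeval (yFun M K N I V t)).mapMatrix T).mulVec v) ≤
        (1 : ℤ) + vecMin Q.ord v := by
      -- Whichever coordinate is a local parameter bounds the gain by one, through `Y` or through
      -- the adjugate.
      rcases hpar with h1 | h1
      · rw [← h1]
        exact vecMin_mulVec_le_sub Q.ord Q.ord_const hN hQy hfac hvA
      · rw [← h1, ← hord]
        exact vecMin_mulVec_le_det Q.ord Q.ord_const hN hQy T v
    have hvtop : vecMin Q.ord v ≠ ⊤ := by
      obtain ⟨i, hi⟩ := Function.ne_iff.1 hv.1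
      exact ne_top_of_le_ne_top (Q.ord_ne_top _ hi) (vecMin_le Q.ord v i)
    have hge := vecMin_add_one_le Q.ord Q.ord_const hN hres Q.surjective hQ.1 hQ.2 hfac hvA hvtop
      hdet0 fun u u' hu h1 h2 => exists_eq_smul_of_smooth _ c y₀
        (hC c y₀ (by rw [evalEval_spectralPoly, hroot])) u u' hu h1 h2
    rw [hTmap] at hle hge
    exact le_antisymm (by rw [add_comm]; exact hle) hge
  · have hvA : ((aeval (yFun M K N I V t)).mapMatrix (xMatrix M K N I V t (X : ℂ[X]))).mulVec v =
        xFun M K N I V t • v := by rw [hAmap]; exact hv.2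
    have hge := vecMin_le_vecMin_mulVec p.ord p.ord_const hpy T v
    have hle1 := vecMin_mulVec_le_sub p.ord p.ord_const hN hpy hfac hvA
    have hle2 := vecMin_mulVec_le_det p.ord p.ord_const hN hpy T v
    rw [hord] at hle2
    rw [hTmap] at hge hle1 hle2
    refine le_antisymm ?_ hge
    -- Away from `Q` one of `x - c`, `y - y₀` has order at most zero, and the corresponding bound
    -- leaves no gain.
    by_cases hx : 0 < p.ord (xFun M K N I V t - algebraMap ℂ _ c)
    · by_cases hy : 0 < p.ord (yFun M K N I V t - algebraMap ℂ _ y₀)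
      · exact absurd ((hQiff p).1 ⟨hx, hy⟩) hpQ
      · exact hle2.trans (add_le_of_nonpos_left (not_lt.1 hy))
    · exact hle1.trans (add_le_of_nonpos_left (not_lt.1 hx))

end Factors

/-! ### Periodicity in time and the final assembly -/

theorem periodProd_eq_of_modEq {N P : ℕ} {a : ℤ → ℤ → ℂ}
    (h : ∀ s, periodProd N a (s + P) = periodProd N a s) {s s' : ℤ} (hs : s ≡ s' [ZMOD P]) :
    periodProd N a s = periodProd N a s' := by
  obtain ⟨k, hk⟩ := hs.dvd
  have hper : Function.Periodic (periodProd N a) (P : ℤ) := h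
  rw [show s' = s + k * P by linarith]
  exact (hper.int_mul k s).symm

end RndKP

theorem proposition2p9 (M K N : ℕ) (hM : 0 < M) (hK : 0 < K) (hN : 0 < N)
    (hMK : Nat.Coprime M K) (hMKN : Nat.Coprime (M + K) N)
    (I V : ℤ → ℤ → ℂ) (hIV : RndKP.IsPeriodicSolution M K N I V)
    (t : ℤ) (hC : RndKP.IsSmooth M K N I V t) :
    ∃ Q₁ A B P : RndKP.SpectralCurve M K N I V t,
      -- the points are the unique ones with the coordinates in question
      (∀ p, p.HasCoords (RndKP.uOne M K I V t) 0 ↔ p = Q₁) ∧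
      (∀ p, p.HasCoords 0 ((-1) ^ N * RndKP.periodProd N I (t - (M - 1) * K)) ↔ p = A) ∧
      (∀ p, p.HasCoords 0 ((-1) ^ N * RndKP.periodProd N V (t - M * K)) ↔ p = B) ∧
      (∀ p, p.AtInfinity ↔ p = P) ∧
      -- `A` is `A_j` and `B` is `B_i` for the indices `j` and `i` in the given residue classes
      ((∀ s, RndKP.periodProd N I (s + M) = RndKP.periodProd N I s) →
        ∀ j < M, -(j : ℤ) * K ≡ t - (M - 1) * K [ZMOD M] →
          A.HasCoords 0 ((-1) ^ N * RndKP.periodProd N I (-(j : ℤ) * K))) ∧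
      ((∀ s, RndKP.periodProd N V (s + K) = RndKP.periodProd N V s) →
        ∀ i < K, -(i : ℤ) * M ≡ t - M * K [ZMOD K] →
          B.HasCoords 0 ((-1) ^ N * RndKP.periodProd N V (-(i : ℤ) * M))) ∧
      -- the orders of `S v`, `R v` and `L v` at all points of the curve
      ∀ v : Fin N → RndKP.FunctionField M K N I V t, RndKP.IsEigenvector M K N I V t v →
        (Q₁.vecOrd ((RndKP.shiftMatrix N (RndKP.yFun M K N I V t)).mulVec v)
            = Q₁.vecOrd v + (1 : ℤ) ∧
          P.vecOrd ((RndKP.shiftMatrix N (RndKP.yFun M K N I V t)).mulVec v)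
            = P.vecOrd v + (-1 : ℤ) ∧
          ∀ p, p ≠ Q₁ → p ≠ P →
            p.vecOrd ((RndKP.shiftMatrix N (RndKP.yFun M K N I V t)).mulVec v) = p.vecOrd v) ∧
        (A.vecOrd ((RndKP.rMatrix N I (t - (M - 1) * K) (RndKP.yFun M K N I V t)).mulVec v)
            = A.vecOrd v + (1 : ℤ) ∧
          P.vecOrd ((RndKP.rMatrix N I (t - (M - 1) * K) (RndKP.yFun M K N I V t)).mulVec v)
            = P.vecOrd v + (-1 : ℤ) ∧
          ∀ p, p ≠ A → p ≠ P →
            p.vecOrd ((RndKP.rMatrix N I (t - (M - 1) * K) (RndKP.yFun M K N I V t)).mulVec v)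
              = p.vecOrd v) ∧
        (B.vecOrd ((RndKP.lMatrix N V (t - M * K) (RndKP.yFun M K N I V t)).mulVec v)
            = B.vecOrd v + (1 : ℤ) ∧
          P.vecOrd ((RndKP.lMatrix N V (t - M * K) (RndKP.yFun M K N I V t)).mulVec v)
            = P.vecOrd v + (-1 : ℤ) ∧
          ∀ p, p ≠ B → p ≠ P →
            p.vecOrd ((RndKP.lMatrix N V (t - M * K) (RndKP.yFun M K N I V t)).mulVec v)
              = p.vecOrd v) := by
  have := RndKP.isDomain_coordinateRing (I := I) (V := V) (t := t) hN hMKN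
  obtain ⟨P, hP, hPy⟩ := RndKP.SpectralCurve.exists_atInfinity (I := I) (V := V) (t := t) hN hM hMKN
  have hfin : ∀ p : RndKP.SpectralCurve M K N I V t, p ≠ P → 0 ≤ p.ord (RndKP.yFun M K N I V t) :=
    fun p hp => not_lt.1 fun h => hp ((hP p).1 ((p.atInfinity_iff hN hM hMKN).2 h))
  obtain ⟨Y₁, hY₁⟩ := RndKP.xMatrix_sub_eq_mul_shiftMatrix hN M K I V t
  obtain ⟨Y₂, hY₂⟩ := RndKP.xMatrix_eq_mul_rMatrix hM K N I V t (X : ℂ[X])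
  obtain ⟨Y₃, hY₃⟩ := RndKP.xMatrix_eq_mul_lMatrix hK hIV t (X : ℂ[X])
  obtain ⟨Q₁, hQ₁, hS⟩ := RndKP.exists_point_of_factor hN hC (a := fun _ => 0) hY₁
  obtain ⟨A, hA, hR⟩ := RndKP.exists_point_of_factor hN hC
    (a := fun n => I n (t - (M - 1) * K)) (c := 0) (Y := Y₂) (by rw [hY₂]; simp [RndKP.rMatrix])
  obtain ⟨B, hB, hL⟩ := RndKP.exists_point_of_factor hN hC
    (a := fun n => V n (t - M * K)) (c := 0) (Y := Y₃) (by rw [hY₃]; simp [RndKP.lMatrix])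
  -- `S` has zero diagonal and `N ≥ 1`, so the point attached to it has `y₀ = 0`.
  rw [Finset.prod_eq_zero (i := 1) (Finset.mem_Icc.2 ⟨le_rfl, hN⟩) rfl, mul_zero] at hQ₁
  refine ⟨Q₁, A, B, P, hQ₁, hA, hB, hP, ?_, ?_, fun v hv => ⟨?_, ?_, ?_⟩⟩
  · intro hper j _ hj
    rw [RndKP.periodProd_eq_of_modEq hper hj]
    exact (hA A).2 rfl
  · intro hper i _ hi
    rw [RndKP.periodProd_eq_of_modEq hper hi]
    exact (hB B).2 rfl
  · exact ⟨(hS v hv).1, P.vecOrd_mulVec_infinity hN hMKN hPy _ hv,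
      fun p hp hp' => (hS v hv).2 p hp (hfin p hp')⟩
  · exact ⟨(hR v hv).1, P.vecOrd_mulVec_infinity hN hMKN hPy _ hv,
      fun p hp hp' => (hR v hv).2 p hp (hfin p hp')⟩
  · exact ⟨(hL v hv).1, P.vecOrd_mulVec_infinity hN hMKN hPy _ hv,
      fun p hp hp' => (hL v hv).2 p hp (hfin p hp')⟩
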